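/- All Banach spaces are real, and $\mathbb N=\{1,2,\dots\}$. For $k\in\mathbb N$ and an infinite $M\subseteq\mathbb N$ let $[M]^k$ be the set of $k$-element subsets of $M$; write $s(1)<\dots<s(k)$ for the elements of $s\in[M]^k$ and $M(1)<M(2)<\cdots$ for those of $M$. A finite sequence $(s_j)_{j=1}^l$ in $[M]^k$ is a plegma family if $s_1(i)<\dots<s_l(i)$ for $1\le i\le k$ and $s_l(i)<s_1(i+1)$ for $1\le i<k$. Let $(e_n)_n$ be a Hamel basis of a seminormed space $(E,\|\cdot\|_*)$. It is a $k$-spreading model of a Banach space $X$ if there are vectors $x_s\in X$ ($s\in[\mathbb N]^k$), an infinite $M\subseteq\mathbb N$ and a null sequence $(\delta_n)_n$ of positive reals such that $$\Big|\Big\|\sum_{j=1}^m a_jx_{s_j}\Big\|-\Big\|\sum_{j=1}^m a_je_j\Big\|_*\Big|\le\delta_l$$ for all $1\le m\le l$, all plegma families $(s_j)_{j=1}^m$ in $[M]^k$ with $s_1(1)\ge M(l)$ and all $a_1,\dots,a_m\in[-1,1]$. It is non-trivial if $\|\cdot\|_*$ is a norm; the space it generates is then the completion of $(E,\|\cdot\|_*)$.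 It is unconditional if it is non-trivial and is an unconditional basis of the space it generates. The $1$-iterated spreading models of $X$ are the non-trivial $1$-spreading models of $X$; the $(k+1)$-iterated spreading models of $X$ are the non-trivial $1$-spreading models of the spaces generated by the $k$-iterated spreading models of $X$. Theorem. Let $X$ be a reflexive Banach space. (1) If for every $k\in\mathbb N$ every space generated by an unconditional $k$-spreading model of $X$ is reflexive, then for every $k\in\mathbb N$ every space generated by a $k$-iterated spreading model of $X$ is (linearly) isomorphic to the space generated by some unconditional $k$-spreading model of $X$. (2) Let $k\in\mathbb N$. If every space generated by a $k$-iterated spreading model of $X$ is reflexive, then every space generated by a $(k+1)$-iterated spreading model of $X$ is isomorphic to the space generated by some unconditional $(k+1)$-spreading model of $X$. -/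

import Mathlib

open Filter Topology

noncomputable section

namespace FiniteOrder

/-- The `k`-element subsets of `ℕ`, each identified with its increasing enumeration. -/
abbrev KSubset (k : ℕ) : Type := Fin k ↪o ℕ

/-- `s 0, …, s (l - 1)` is a plegma family: for each position `i` the `i`-th elements strictly
increase along the family, and the `i`-th element of any member lies below the `(i + 1)`-st
element of any member (it is enough to compare the last member with the first). -/
def IsPlegma {k l : ℕ} (s : Fin l → KSubset k) : Prop :=
  (∀ i : Fin k, StrictMono fun j => s j i) ∧
    ∀ i i' : Fin k, i < i' → ∀ j j' : Fin l, s j i < s j' i'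

/-- The space `c₀₀` of finitely supported real sequences, equipped with the seminorm `p`. -/
def C00 (_p : Seminorm ℝ (ℕ →₀ ℝ)) : Type := ℕ →₀ ℝ

instance (p : Seminorm ℝ (ℕ →₀ ℝ)) : SeminormedAddCommGroup (C00 p) :=
  p.toAddGroupSeminorm.toSeminormedAddCommGroup

instance (p : Seminorm ℝ (ℕ →₀ ℝ)) : Module ℝ (C00 p) :=
  inferInstanceAs (Module ℝ (ℕ →₀ ℝ))

instance (p : Seminorm ℝ (ℕ →₀ ℝ)) : NormedSpace ℝ (C00 p) where
  norm_smul_le r x := (map_smul_eq_mul p r x).le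

/-- A finitely supported sequence, as an element of `(c₀₀, p)`. -/
def C00.of (p : Seminorm ℝ (ℕ →₀ ℝ)) : (ℕ →₀ ℝ) ≃ₗ[ℝ] C00 p :=
  LinearEquiv.refl ℝ (ℕ →₀ ℝ)

theorem C00.norm_of (p : Seminorm ℝ (ℕ →₀ ℝ)) (a : ℕ →₀ ℝ) : ‖C00.of p a‖ = p a := rfl

/-- The Banach space generated by the unit vectors of `c₀₀` under the seminorm `p`:
the completion of `(c₀₀, p)`. -/
abbrev GeneratedSpace (p : Seminorm ℝ (ℕ →₀ ℝ)) : Type := UniformSpace.Completion (C00 p)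

/-- The `n`-th unit vector, in the generated space. -/
def unitVec (p : Seminorm ℝ (ℕ →₀ ℝ)) (n : ℕ) : GeneratedSpace p :=
  (C00.of p (Finsupp.single n 1) : UniformSpace.Completion (C00 p))

section SpreadingModels

variable {X : Type*} [NormedAddCommGroup X] [NormedSpace ℝ X]

/-- The `k`-subsequence `(x s)`, `s ∈ [M]^k`, generates, with respect to `δ`, the Hamel basis
`e n = Finsupp.single n 1` of `(c₀₀, p)` as a `k`-spreading model.

The strictly increasing `M` enumerates the infinite set denoted by the same letter. Everything is
counted from `0`, so that the plegma families have `m + 1 ≤ l + 1` members. For `k ≥ 1` the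
condition `∀ j i, M l ≤ s j i` says that the first element of `s 0`, which is the least element
in the family, is at least `M l`. -/
def Generates (k : ℕ) (x : KSubset k → X) (M : ℕ ↪o ℕ) (δ : ℕ → ℝ)
    (p : Seminorm ℝ (ℕ →₀ ℝ)) : Prop :=
  ∀ l m : ℕ, m ≤ l → ∀ s : Fin (m + 1) → KSubset k, IsPlegma s →
    (∀ j i, s j i ∈ Set.range M) → (∀ j i, M l ≤ s j i) →
    ∀ a : Fin (m + 1) → ℝ, (∀ j, a j ∈ Set.Icc (-1 : ℝ) 1) →
      |‖∑ j, a j • x (s j)‖ - p (∑ j, a j • Finsupp.single (j : ℕ) (1 : ℝ))| ≤ δ l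

variable (X) in
/-- The unit vector sequence of `(c₀₀, p)` is a `k`-spreading model of `X`. A sequence which is
the Hamel basis of a seminormed space is, up to isometry, of this form. -/
def IsSpreadingModel (k : ℕ) (p : Seminorm ℝ (ℕ →₀ ℝ)) : Prop :=
  ∃ (x : KSubset k → X) (M : ℕ ↪o ℕ) (δ : ℕ → ℝ),
    (∀ n, 0 < δ n) ∧ Tendsto δ atTop (𝓝 0) ∧ Generates k x M δ p

/-- No nonzero linear combination of the unit vectors is null for `p`, that is, `p` is a norm. -/
def IsNontrivial (p : Seminorm ℝ (ℕ →₀ ℝ)) : Prop :=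
  ∀ a : ℕ →₀ ℝ, p a = 0 → a = 0

/-- The unit vector sequence is nontrivial and is an unconditional basis of the space that it
generates. -/
def IsUnconditional (p : Seminorm ℝ (ℕ →₀ ℝ)) : Prop :=
  IsNontrivial p ∧
    ∃ b : UnconditionalSchauderBasis ℕ ℝ (GeneratedSpace p), ∀ n, b n = unitVec p n

variable (X) in
/-- The `k`-iterated spreading models of `X`, for `k = 1, 2, …`: the `1`-iterated ones are the
nontrivial spreading models of `X`, and the `(k + 1)`-iterated ones are the nontrivial spreading
models of the spaces generated by the `k`-iterated ones. -/
inductive IsIteratedSpreadingModel : ℕ → Seminorm ℝ (ℕ →₀ ℝ) → Prop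
  | one (p : Seminorm ℝ (ℕ →₀ ℝ)) (hp : IsNontrivial p) (h : IsSpreadingModel X 1 p) :
      IsIteratedSpreadingModel 1 p
  | succ (k : ℕ) (q p : Seminorm ℝ (ℕ →₀ ℝ)) (hq : IsIteratedSpreadingModel k q)
      (hp : IsNontrivial p) (h : IsSpreadingModel (GeneratedSpace q) 1 p) :
      IsIteratedSpreadingModel (k + 1) p

end SpreadingModels

/-- The canonical embedding of `X` into its bidual is onto. -/
def IsReflexive (X : Type*) [NormedAddCommGroup X] [NormedSpace ℝ X] : Prop :=
  Function.Surjective (NormedSpace.inclusionInDoubleDual ℝ X)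

end FiniteOrder

end

/-! Reflexivity allows a weak limit to be subtracted, and what remains is unconditional. Let `y` be
a bounded sequence in a reflexive space whose spreading model `r` is nontrivial, and let `x` be its
weak limit along a fixed nonprincipal ultrafilter. Seminorms of spreading models are iterated limits
of norms along that ultrafilter. For the weakly null sequence `z = y - x`, weak lower semicontinuity
of convex functions shows that deleting a coefficient does not increase these limits, so the model
`p` of `z` is unconditional. Moreover `r a` is equivalent to `p a + ‖x‖ * |∑ a i|`. Hence `r`
generates either the space of `p` or that space plus a line, and these are isomorphic because the
shift is a `p`-isometry (`nonempty_equiv_of_coordSum`, `exists_isWeaklyNull_model`).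

It remains to compress two steps into one (`IsSpreadingModel.comp`). Let `q` be an unconditional
`k`-spreading model of `X`, generated by vectors `x s`. A weakly null sequence in the space of `q`
has a subsequence close to a sequence of successive blocks of the basis. In each block the basis
vectors are replaced by vectors `x t`: the first element of a `(k + 1)`-set selects the block, the
other `k` elements determine the sets `t`. If these elements are spread out far enough, a plegma
family of `(k + 1)`-sets yields a single plegma family of `k`-sets, so norms in `X` are close to
norms of combinations of blocks.

Both parts follow by induction on `k`. In the second part reflexivity is also needed at lower
orders, and it is inherited because a spreading model is a spreading model of the space it
generates. -/

noncomputable section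

namespace FiniteOrder

/-! ### Generated spaces -/

/-- The canonical map of `c₀₀` into the space generated by `p`. -/
def toGen (p : Seminorm ℝ (ℕ →₀ ℝ)) : (ℕ →₀ ℝ) →ₗ[ℝ] GeneratedSpace p :=
  (UniformSpace.Completion.toComplₗᵢ (𝕜 := ℝ) (E := C00 p)).toLinearMap ∘ₗ (C00.of p).toLinearMap

theorem norm_toGen (p : Seminorm ℝ (ℕ →₀ ℝ)) (a : ℕ →₀ ℝ) : ‖toGen p a‖ = p a :=
  UniformSpace.Completion.norm_coe _

theorem denseRange_toGen (p : Seminorm ℝ (ℕ →₀ ℝ)) : DenseRange (toGen p) :=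
  UniformSpace.Completion.denseRange_coe (α := C00 p)

theorem toGen_single (p : Seminorm ℝ (ℕ →₀ ℝ)) (n : ℕ) :
    toGen p (Finsupp.single n 1) = unitVec p n := rfl

theorem exists_toGen_near (p : Seminorm ℝ (ℕ →₀ ℝ)) (x : GeneratedSpace p) {ε : ℝ} (hε : 0 < ε) :
    ∃ a, ‖x - toGen p a‖ < ε := by
  obtain ⟨a, ha⟩ := Metric.denseRange_iff.1 (denseRange_toGen p) x ε hε
  exact ⟨a, by rwa [← dist_eq_norm]⟩

/-- A linear map on `c₀₀` with dense range, whose norm is equivalent to `p`, identifies the space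
generated by `p` with its codomain. -/
theorem nonempty_equiv_of_bounds {p : Seminorm ℝ (ℕ →₀ ℝ)} {W : Type*} [NormedAddCommGroup W]
    [NormedSpace ℝ W] [CompleteSpace W] (φ : (ℕ →₀ ℝ) →ₗ[ℝ] W) (hφ : DenseRange φ) {C D : ℝ}
    (hC : ∀ a, ‖φ a‖ ≤ C * p a) (hD : ∀ a, p a ≤ D * ‖φ a‖) :
    Nonempty (GeneratedSpace p ≃L[ℝ] W) :=
  ⟨(LinearEquiv.refl ℝ (ℕ →₀ ℝ)).extend (toGen p) φ (denseRange_toGen p)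
    ⟨C, fun a => by simpa [norm_toGen] using hC a⟩ hφ
    ⟨D, fun a => by simpa [norm_toGen] using hD a⟩⟩

theorem nonempty_equiv_of_equivalent {p q : Seminorm ℝ (ℕ →₀ ℝ)} {C D : ℝ}
    (hC : ∀ a, q a ≤ C * p a) (hD : ∀ a, p a ≤ D * q a) :
    Nonempty (GeneratedSpace p ≃L[ℝ] GeneratedSpace q) :=
  nonempty_equiv_of_bounds (toGen q) (denseRange_toGen q)
    (fun a => by simpa [norm_toGen] using hC a) (fun a => by simpa [norm_toGen] using hD a)

/-- Deleting a coordinate does not increase the seminorm. -/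
def IsSuppression (p : Seminorm ℝ (ℕ →₀ ℝ)) : Prop := ∀ a i, p (a.erase i) ≤ p a

/-- The seminorm is invariant under the right shift. -/
def IsShiftInvariant (p : Seminorm ℝ (ℕ →₀ ℝ)) : Prop :=
  ∀ a : ℕ →₀ ℝ, p (a.mapDomain Nat.succ) = p a

theorem IsSuppression.sum_single_le {p : Seminorm ℝ (ℕ →₀ ℝ)} (hp : IsSuppression p)
    (a : ℕ →₀ ℝ) (A : Finset ℕ) : p (∑ i ∈ A, Finsupp.single i (a i)) ≤ p a := by
  have key : ∀ B : Finset ℕ, p (a.filter (· ∉ B)) ≤ p a := by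
    intro B
    induction B using Finset.induction_on with
    | empty =>
      rw [(Finsupp.filter_eq_self_iff _ a).2 (by simp)]
    | insert i B hi ih =>
      have : a.filter (· ∉ insert i B) = (a.filter (· ∉ B)).erase i := by
        ext j
        by_cases h : j = i <;> by_cases h' : j ∈ B <;> simp [h, h']
      rw [this]
      exact (hp _ _).trans ih
  have : ∑ i ∈ A, Finsupp.single i (a i) = a.filter (· ∉ a.support \ A) := by
    ext j
    by_cases h : j ∈ A <;> by_cases h' : a j = 0 <;>
      simp [h, h', Finsupp.finsetSum_apply, Finsupp.single_apply]
  rw [this]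
  exact key _

theorem map_single (p : Seminorm ℝ (ℕ →₀ ℝ)) (i : ℕ) (c : ℝ) :
    p (Finsupp.single i c) = |c| * p (Finsupp.single i 1) := by
  rw [← Real.norm_eq_abs, ← map_smul_eq_mul]; simp

theorem IsSuppression.abs_apply_mul_le {p : Seminorm ℝ (ℕ →₀ ℝ)} (hp : IsSuppression p)
    (a : ℕ →₀ ℝ) (i : ℕ) : |a i| * p (Finsupp.single i 1) ≤ p a := by
  simpa [map_single p i (a i)] using hp.sum_single_le a {i}

theorem IsNontrivial.single_pos {p : Seminorm ℝ (ℕ →₀ ℝ)} (hp : IsNontrivial p) (i : ℕ) :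
    0 < p (Finsupp.single i 1) :=
  lt_of_le_of_ne (apply_nonneg _ _) fun h => by simpa using hp _ h.symm

/-- All coordinate projections onto finite sets are contractions, and on a finitely supported vector
they are eventually the identity. Density of these vectors gives unconditional convergence of every
expansion. -/
theorem IsSuppression.isUnconditional {p : Seminorm ℝ (ℕ →₀ ℝ)} (hs : IsSuppression p)
    (hp : IsNontrivial p) : IsUnconditional p := by
  classical
  refine ⟨hp, ?_⟩
  have hb : ∀ i, ∃ C, ∀ a, ‖Finsupp.lapply (R := ℝ) (M := ℝ) i a‖ ≤ C * ‖toGen p a‖ := fun i => by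
    refine ⟨(p (Finsupp.single i 1))⁻¹, fun a => ?_⟩
    rw [norm_toGen, inv_mul_eq_div, le_div_iff₀ (hp.single_pos i)]
    exact hs.abs_apply_mul_le a i
  let f : ℕ → StrongDual ℝ (GeneratedSpace p) := fun i =>
    (Finsupp.lapply (R := ℝ) (M := ℝ) i).extendOfNorm (toGen p)
  have hf : ∀ i a, f i (toGen p a) = a i := fun i a =>
    LinearMap.extendOfNorm_eq (denseRange_toGen p) (hb i) a
  have hsum : ∀ (A : Finset ℕ) a, ∑ i ∈ A, f i (toGen p a) • unitVec p i =
      toGen p (∑ i ∈ A, Finsupp.single i (a i)) := fun A a => by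
    rw [map_sum]
    refine Finset.sum_congr rfl fun i _ => ?_
    rw [hf, ← toGen_single, ← map_smul]
    simp
  have hP : ∀ (A : Finset ℕ) x, ‖∑ i ∈ A, f i x • unitVec p i‖ ≤ ‖x‖ := fun A x => by
    refine (denseRange_toGen p).induction_on x
      (isClosed_le (by fun_prop) continuous_norm) fun a => ?_
    rw [hsum, norm_toGen, norm_toGen]
    exact hs.sum_single_le a A
  refine ⟨⟨unitVec p, f, fun i j => ?_, fun x => ?_⟩, fun n => rfl⟩
  · rw [← toGen_single, hf]
    simp [Finsupp.single_apply, Pi.single_apply, eq_comm]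
  · rw [HasSum, SummationFilter.unconditional_filter, Metric.tendsto_atTop]
    intro ε hε
    obtain ⟨a, ha⟩ := exists_toGen_near p x (half_pos hε)
    refine ⟨a.support, fun A hA => ?_⟩
    have h1 : ∑ i ∈ A, f i (toGen p a) • unitVec p i = toGen p a := by
      rw [hsum]
      congr 1
      ext j
      simp only [Finsupp.finsetSum_apply, Finsupp.single_apply, Finset.sum_ite_eq']
      split_ifs with h
      · rfl
      · by_contra h'
        exact h (hA (Finsupp.mem_support_iff.2 (Ne.symm h')))
    have h2 : ∑ i ∈ A, f i x • unitVec p i - x =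
        ∑ i ∈ A, f i (x - toGen p a) • unitVec p i - (x - toGen p a) := by
      simp only [map_sub, sub_smul, Finset.sum_sub_distrib, h1]
      abel
    rw [dist_eq_norm, h2]
    calc _ ≤ ‖x - toGen p a‖ + ‖x - toGen p a‖ := (norm_sub_le _ _).trans (by gcongr; exact hP _ _)
      _ < ε := by linarith

/-- The left shift on `c₀₀`. -/
def leftShift : (ℕ →₀ ℝ) →ₗ[ℝ] (ℕ →₀ ℝ) := Finsupp.lcomapDomain Nat.succ Nat.succ_injective

theorem leftShift_apply (a : ℕ →₀ ℝ) (n : ℕ) : leftShift a n = a (n + 1) := rfl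

theorem mapDomain_succ_zero (a : ℕ →₀ ℝ) : a.mapDomain Nat.succ 0 = 0 :=
  Finsupp.mapDomain_of_notMem_range _ _ (by simp)

theorem mapDomain_succ_succ (a : ℕ →₀ ℝ) (n : ℕ) : a.mapDomain Nat.succ (n + 1) = a n :=
  Finsupp.mapDomain_apply Nat.succ_injective _ _

theorem single_add_mapDomain_leftShift (a : ℕ →₀ ℝ) :
    Finsupp.single 0 (a 0) + (leftShift a).mapDomain Nat.succ = a := by
  ext n
  cases n <;> simp [mapDomain_succ_zero, mapDomain_succ_succ, leftShift_apply]

theorem mapDomain_leftShift (a : ℕ →₀ ℝ) : (leftShift a).mapDomain Nat.succ = a.erase 0 := by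
  ext n
  cases n <;> simp [mapDomain_succ_zero, mapDomain_succ_succ, leftShift_apply]

/-- Splitting off the coordinate `0` leaves a tail which the shift identifies isometrically with the
whole space. -/
theorem nonempty_equiv_prod {p : Seminorm ℝ (ℕ →₀ ℝ)} (hs : IsSuppression p)
    (hsh : IsShiftInvariant p) (hp : IsNontrivial p) :
    Nonempty (GeneratedSpace p ≃L[ℝ] GeneratedSpace p × ℝ) := by
  have h0 := hp.single_pos 0
  refine nonempty_equiv_of_bounds (((toGen p) ∘ₗ leftShift).prod (Finsupp.lapply 0)) ?_
    (C := 1 + (p (Finsupp.single 0 1))⁻¹) (D := p (Finsupp.single 0 1) + 1) ?_ ?_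
  · have : Set.range (((toGen p) ∘ₗ leftShift).prod (Finsupp.lapply 0)) =
        Set.range (toGen p) ×ˢ Set.univ := by
      ext ⟨x, t⟩
      constructor
      · rintro ⟨a, ha⟩
        simp only [Prod.ext_iff] at ha
        exact ⟨⟨_, ha.1⟩, trivial⟩
      · rintro ⟨⟨a, rfl⟩, -⟩
        refine ⟨Finsupp.single 0 t + a.mapDomain Nat.succ, ?_⟩
        have : leftShift (Finsupp.single 0 t + a.mapDomain Nat.succ) = a := by
          ext n
          simp [leftShift_apply, mapDomain_succ_succ]
        simp [this, mapDomain_succ_zero]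
    rw [DenseRange, this]
    exact (denseRange_toGen p).prod dense_univ
  · intro a
    have h1 : p (leftShift a) ≤ p a := by
      rw [← hsh, mapDomain_leftShift]; exact hs _ _
    have h2 : |a 0| ≤ (p (Finsupp.single 0 1))⁻¹ * p a := by
      rw [inv_mul_eq_div, le_div_iff₀ h0]; exact hs.abs_apply_mul_le a 0
    have h3 := apply_nonneg p a
    have h4 : 0 ≤ (p (Finsupp.single 0 1))⁻¹ * p a := by positivity
    refine max_le (?_ : ‖toGen p (leftShift a)‖ ≤ _) (?_ : |a 0| ≤ _)
    · rw [norm_toGen]; linarith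
    · linarith
  · intro a
    set N := ‖(((toGen p) ∘ₗ leftShift).prod (Finsupp.lapply 0)) a‖ with hN
    have h1 : p (leftShift a) ≤ N := by
      rw [← norm_toGen]; exact le_max_left _ _
    have h2 : |a 0| ≤ N := le_max_right _ _
    calc p a = p (Finsupp.single 0 (a 0) + (leftShift a).mapDomain Nat.succ) := by
          rw [single_add_mapDomain_leftShift]
      _ ≤ |a 0| * p (Finsupp.single 0 1) + p (leftShift a) := by
          rw [← map_single, ← hsh (leftShift a)]; exact map_add_le_add _ _ _
      _ ≤ _ := by nlinarith

/-- The sum of the coordinates. -/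
def coordSum : (ℕ →₀ ℝ) →ₗ[ℝ] ℝ := Finsupp.linearCombination ℝ fun _ => (1 : ℝ)

/-- If `t * |coordSum|` is dominated by `p`, then `r` and `p` are equivalent. Otherwise the graph of
the discontinuous functional `t • coordSum` is dense in the product with `ℝ`, so `r` generates that
product, which absorbs the extra line by `nonempty_equiv_prod`. -/
theorem nonempty_equiv_of_coordSum {p r : Seminorm ℝ (ℕ →₀ ℝ)} (hs : IsSuppression p)
    (hsh : IsShiftInvariant p) (hp : IsNontrivial p) {t C D : ℝ} (ht : 0 ≤ t) (hD0 : 0 ≤ D)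
    (hC : ∀ a, p a + t * |coordSum a| ≤ C * r a) (hD : ∀ a, r a ≤ D * (p a + t * |coordSum a|)) :
    Nonempty (GeneratedSpace r ≃L[ℝ] GeneratedSpace p) := by
  by_cases hK : ∃ K, ∀ a, t * |coordSum a| ≤ K * p a
  · obtain ⟨K, hK⟩ := hK
    refine nonempty_equiv_of_equivalent (C := C) (D := D * (1 + K)) (fun a => ?_) fun a => ?_
    · have := hC a
      have : 0 ≤ t * |coordSum a| := by positivity
      linarith
    · have := hK a
      have := hD a
      nlinarith
  · push Not at hK
    let φ : (ℕ →₀ ℝ) →ₗ[ℝ] GeneratedSpace p × ℝ := (toGen p).prod (t • coordSum)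
    have hnorm : ∀ a, ‖φ a‖ = max (p a) (t * |coordSum a|) := fun a => by
      simp [φ, Prod.norm_def, norm_toGen, abs_of_nonneg ht]
    have hdense : DenseRange φ := by
      let V : Submodule ℝ (GeneratedSpace p × ℝ) := (LinearMap.range φ).topologicalClosure
      have hV : IsClosed (V : Set (GeneratedSpace p × ℝ)) :=
        Submodule.isClosed_topologicalClosure _
      have hφV : ∀ a, φ a ∈ V := fun a => Submodule.le_topologicalClosure _ ⟨a, rfl⟩
      have h01 : ((0, 1) : GeneratedSpace p × ℝ) ∈ V := by
        rw [← SetLike.mem_coe, ← hV.closure_eq, Metric.mem_closure_iff]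
        intro ε hε
        -- Dividing `a` by `t * coordSum a` makes the second coordinate `1` and the first smaller
        -- than `ε`.
        obtain ⟨a, ha⟩ := hK (2 * ε⁻¹)
        set s := t * coordSum a with hs'
        have hsabs : |s| = t * |coordSum a| := by rw [hs', abs_mul, abs_of_nonneg ht]
        have hp0 := apply_nonneg p a
        have hspos : 0 < |s| := by
          rw [hsabs]; exact lt_of_le_of_lt (by positivity) ha
        have hs0 : s ≠ 0 := abs_pos.1 hspos
        refine ⟨φ (s⁻¹ • a), hφV _, ?_⟩
        have : (0, 1) - φ (s⁻¹ • a) = (-(s⁻¹ • toGen p a), 0) := by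
          refine Prod.ext (by simp [φ]) ?_
          have : t * (s⁻¹ * coordSum a) = 1 := by
            rw [mul_left_comm, ← hs', inv_mul_cancel₀ hs0]
          simp only [φ, LinearMap.prod_apply, Prod.snd_sub, map_smul, Prod.smul_snd, Function.prod,
            LinearMap.smul_apply, smul_eq_mul]
          linarith
        rw [dist_eq_norm, this, Prod.norm_def]
        simp only [norm_neg, norm_smul, norm_toGen, norm_zero, norm_inv, Real.norm_eq_abs]
        refine max_lt ?_ hε
        rw [inv_mul_eq_div, div_lt_iff₀ hspos, hsabs]
        calc p a ≤ ε * (2 * ε⁻¹ * p a) := by field_simp; linarith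
          _ < _ := by gcongr
      have hx0 : ∀ a, ((toGen p a, 0) : GeneratedSpace p × ℝ) ∈ V := fun a => by
        have := V.sub_mem (hφV a) (V.smul_mem (t * coordSum a) h01)
        simpa [φ] using this
      have hxV : ∀ x : GeneratedSpace p, ((x, 0) : GeneratedSpace p × ℝ) ∈ V := fun x =>
        (denseRange_toGen p).induction_on x (hV.preimage (by fun_prop)) hx0
      intro y
      have := V.add_mem (hxV y.1) (V.smul_mem y.2 h01)
      have hy : y ∈ V := by simpa using this
      exact hy
    obtain ⟨e₁⟩ := nonempty_equiv_of_bounds (p := r) φ hdense (C := C) (D := 2 * D) (fun a => by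
        rw [hnorm]
        have := hC a
        have := apply_nonneg p a
        have : 0 ≤ t * |coordSum a| := by positivity
        exact max_le (by linarith) (by linarith)) (fun a => by
        rw [hnorm, mul_assoc, mul_left_comm]
        refine (hD a).trans ?_
        gcongr
        linarith [le_max_left (p a) (t * |coordSum a|), le_max_right (p a) (t * |coordSum a|)])
    obtain ⟨e₂⟩ := nonempty_equiv_prod hs hsh hp
    exact ⟨e₁.trans e₂.symm⟩

/-! ### Iterated limits along a nonprincipal ultrafilter -/

section IteratedLimits

variable {Z : Type*} [NormedAddCommGroup Z] [NormedSpace ℝ Z]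

theorem exists_tendsto_hyperfilter {g : ℕ → ℝ} {a b : ℝ} (hg : ∀ n, g n ∈ Set.Icc a b) :
    ∃ c, Tendsto g (hyperfilter ℕ : Filter ℕ) (𝓝 c) := by
  obtain ⟨c, -, hc⟩ := (isCompact_Icc (a := a) (b := b)).ultrafilter_le_nhds
    ((hyperfilter ℕ).map g) (by
      rw [Ultrafilter.coe_map, le_principal_iff]
      exact Filter.mem_map.2 (Filter.univ_mem' hg))
  exact ⟨c, hc⟩

/-- The iterated limit of `‖v + f 0 • z n₀ + ⋯ + f (N - 1) • z n_{N - 1}‖` as `n_{N - 1}`, …, `n₀`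
tend, in this order, to infinity along a fixed nonprincipal ultrafilter. -/
def iterLim (z : ℕ → Z) : ℕ → (ℕ → ℝ) → Z → ℝ
  | 0, _, v => ‖v‖
  | N + 1, f, v => limUnder (hyperfilter ℕ : Filter ℕ)
      fun n => iterLim z N (fun i => f (i + 1)) (v + f 0 • z n)

variable {z : ℕ → Z} {C : ℝ}

theorem iterLim_congr {N : ℕ} {f g : ℕ → ℝ} (h : ∀ i < N, f i = g i) (v : Z) :
    iterLim z N f v = iterLim z N g v := by
  induction N generalizing f g v with
  | zero => rfl
  | succ N ih =>
    simp only [iterLim, h 0 (Nat.succ_pos N)]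
    congr 1
    ext n
    exact ih (fun i hi => h (i + 1) (Nat.succ_lt_succ hi)) _

theorem iterLim_mem_Icc (hz : ∀ n, ‖z n‖ ≤ C) (N : ℕ) (f : ℕ → ℝ) (v : Z) :
    iterLim z N f v ∈ Set.Icc 0 (‖v‖ + C * ∑ i ∈ Finset.range N, |f i|) := by
  induction N generalizing f v with
  | zero => simp [iterLim]
  | succ N ih =>
    have key : ∀ n, iterLim z N (fun i => f (i + 1)) (v + f 0 • z n) ∈
        Set.Icc 0 (‖v‖ + C * ∑ i ∈ Finset.range (N + 1), |f i|) := fun n => by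
      refine ⟨(ih _ _).1, (ih _ _).2.trans ?_⟩
      have h1 : ‖v + f 0 • z n‖ ≤ ‖v‖ + |f 0| * C := by
        refine (norm_add_le _ _).trans ?_
        rw [norm_smul, Real.norm_eq_abs]
        gcongr
        exact hz n
      rw [Finset.sum_range_succ']
      linarith
    obtain ⟨c, hc⟩ := exists_tendsto_hyperfilter key
    rw [iterLim, hc.limUnder_eq]
    exact isClosed_Icc.mem_of_tendsto hc (Eventually.of_forall key)

theorem tendsto_iterLim (hz : ∀ n, ‖z n‖ ≤ C) (N : ℕ) (f : ℕ → ℝ) (v : Z) :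
    Tendsto (fun n => iterLim z N (fun i => f (i + 1)) (v + f 0 • z n))
      (hyperfilter ℕ : Filter ℕ) (𝓝 (iterLim z (N + 1) f v)) := by
  refine tendsto_nhds_limUnder (exists_tendsto_hyperfilter (a := 0)
    (b := ‖v‖ + |f 0| * C + C * ∑ i ∈ Finset.range N, |f (i + 1)|) fun n => ?_)
  have h := iterLim_mem_Icc hz N (fun i => f (i + 1)) (v + f 0 • z n)
  refine ⟨h.1, h.2.trans ?_⟩
  gcongr
  refine (norm_add_le _ _).trans ?_
  rw [norm_smul, Real.norm_eq_abs]
  gcongr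
  exact hz n

theorem iterLim_add_le (hz : ∀ n, ‖z n‖ ≤ C) (N : ℕ) (f g : ℕ → ℝ) (v w : Z) :
    iterLim z N (f + g) (v + w) ≤ iterLim z N f v + iterLim z N g w := by
  induction N generalizing f g v w with
  | zero => exact norm_add_le _ _
  | succ N ih =>
    refine le_of_tendsto_of_tendsto' (tendsto_iterLim hz N (f + g) (v + w))
      ((tendsto_iterLim hz N f v).add (tendsto_iterLim hz N g w)) fun n => ?_
    refine le_trans (le_of_eq ?_) (ih _ _ _ _)
    congr 1
    simp only [Pi.add_apply]
    module

theorem iterLim_smul (hz : ∀ n, ‖z n‖ ≤ C) (N : ℕ) (c : ℝ) (f : ℕ → ℝ) (v : Z) :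
    iterLim z N (c • f) (c • v) = |c| * iterLim z N f v := by
  induction N generalizing f v with
  | zero => exact norm_smul _ _
  | succ N ih =>
    refine tendsto_nhds_unique (tendsto_iterLim hz N (c • f) (c • v))
      (((tendsto_iterLim hz N f v).const_mul |c|).congr fun n => ?_)
    rw [← ih]
    congr 1
    simp only [Pi.smul_apply, smul_eq_mul]
    module

/-- Limits over indices with zero coefficient are limits of constants. This makes the number of
limits irrelevant in `iterSeminorm`. -/
theorem iterLim_add_of_zero (N d : ℕ) {f : ℕ → ℝ} (hf : ∀ i, N ≤ i → f i = 0) (v : Z) :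
    iterLim z (N + d) f v = iterLim z N f v := by
  induction N generalizing f v with
  | zero =>
    induction d generalizing f v with
    | zero => rfl
    | succ d ih =>
      have h0 := hf 0 le_rfl
      have : ∀ n, iterLim z (0 + d) (fun i => f (i + 1)) (v + f 0 • z n) = ‖v‖ := fun n => by
        rw [ih fun i _ => hf _ (Nat.zero_le _), h0]
        simp [iterLim]
      have h : iterLim z (0 + d + 1) f v = limUnder (hyperfilter ℕ : Filter ℕ) fun _ => ‖v‖ := by
        simp only [iterLim, this]
      exact h.trans tendsto_const_nhds.limUnder_eq
  | succ N ih =>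
    rw [Nat.add_right_comm]
    simp only [iterLim]
    congr 1
    ext n
    exact ih (fun i hi => hf _ (Nat.succ_le_succ hi)) _

theorem abs_iterLim_sub_le (hz : ∀ n, ‖z n‖ ≤ C) (N : ℕ) (f g : ℕ → ℝ) (v w : Z) :
    |iterLim z N f v - iterLim z N g w| ≤ ‖v - w‖ + C * ∑ i ∈ Finset.range N, |f i - g i| := by
  have key : ∀ (f g : ℕ → ℝ) (v w : Z), iterLim z N f v - iterLim z N g w ≤
      ‖v - w‖ + C * ∑ i ∈ Finset.range N, |f i - g i| := fun f g v w => by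
    have h1 := iterLim_add_le hz N g (f - g) w (v - w)
    rw [add_sub_cancel, add_sub_cancel] at h1
    have h2 := (iterLim_mem_Icc hz N (f - g) (v - w)).2
    simp only [Pi.sub_apply] at h2
    linarith
  refine abs_sub_le_iff.2 ⟨key _ _ _ _, ?_⟩
  have := key g f w v
  simp only [norm_sub_rev w v, fun i => abs_sub_comm (g i) (f i)] at this
  exact this

/-- Translating the sequence only moves the initial vector, by the sum of the coefficients. This is
the source of `coordSum` in the comparison of `y` with `y - x`. -/
theorem iterLim_sub_const (y : ℕ → Z) (x : Z) (N : ℕ) (f : ℕ → ℝ) (v : Z) :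
    iterLim y N f v =
      iterLim (fun n => y n - x) N f (v + (∑ i ∈ Finset.range N, f i) • x) := by
  induction N generalizing f v with
  | zero => simp [iterLim]
  | succ N ih =>
    simp only [iterLim]
    congr 1
    ext n
    rw [ih, Finset.sum_range_succ']
    congr 1
    module

theorem iterLim_comp_le {Y : Type*} [NormedAddCommGroup Y] [NormedSpace ℝ Y] (T : Z →L[ℝ] Y)
    (hz : ∀ n, ‖z n‖ ≤ C) (N : ℕ) (f : ℕ → ℝ) (v : Z) :
    iterLim (fun n => T (z n)) N f (T v) ≤ ‖T‖ * iterLim z N f v := by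
  have hz' : ∀ n, ‖T (z n)‖ ≤ ‖T‖ * C := fun n => T.le_opNorm_of_le (hz n)
  induction N generalizing f v with
  | zero => exact T.le_opNorm _
  | succ N ih =>
    refine le_of_tendsto_of_tendsto' (tendsto_iterLim hz' N f (T v))
      ((tendsto_iterLim hz N f v).const_mul ‖T‖) fun n => ?_
    rw [← map_smul, ← map_add]
    exact ih _ _

theorem linearCombination_eq_sum_range (v : ℕ → Z) (a : ℕ →₀ ℝ) {N : ℕ}
    (hN : ∀ i, N ≤ i → a i = 0) :
    Finsupp.linearCombination ℝ v a = ∑ i ∈ Finset.range N, a i • v i := by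
  rw [Finsupp.linearCombination_apply]
  refine Finsupp.sum_of_support_subset _ (fun i hi => ?_) _ fun i _ => zero_smul _ _
  rw [Finset.mem_range]
  by_contra h
  exact Finsupp.mem_support_iff.1 hi (hN i (not_lt.1 h))

/-- An upper bound for the support. -/
def degree (a : ℕ →₀ ℝ) : ℕ := a.support.sup id + 1

theorem apply_eq_zero_of_degree_le (a : ℕ →₀ ℝ) (i : ℕ) (hi : degree a ≤ i) : a i = 0 := by
  by_contra h
  have := Finset.le_sup (f := id) (Finsupp.mem_support_iff.2 h)
  simp only [degree, id] at *
  omega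

/-- The seminorm on `c₀₀` given by the iterated limits of `‖∑ i, a i • z nᵢ‖`. -/
def iterSeminorm (z : ℕ → Z) (hz : ∃ C, ∀ n, ‖z n‖ ≤ C) : Seminorm ℝ (ℕ →₀ ℝ) :=
  have indep : ∀ (a : ℕ →₀ ℝ) (N : ℕ), (∀ i, N ≤ i → a i = 0) →
      iterLim z (degree a) a 0 = iterLim z N a 0 := fun a N hN => by
    rw [← iterLim_add_of_zero (degree a) N (apply_eq_zero_of_degree_le a), add_comm,
      iterLim_add_of_zero N (degree a) hN]
  Seminorm.of (fun a => iterLim z (degree a) a 0)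
    (fun a b => by
      obtain ⟨C, hC⟩ := hz
      set N := degree a + degree b + degree (a + b)
      have h : ∀ c : ℕ →₀ ℝ, degree c ≤ N → iterLim z (degree c) c 0 = iterLim z N c 0 :=
        fun c hc => indep c N fun i hi => apply_eq_zero_of_degree_le c i (hc.trans hi)
      rw [h a (by omega), h b (by omega), h (a + b) (by omega)]
      simpa using iterLim_add_le hC N a b 0 0)
    (fun c a => by
      obtain ⟨C, hC⟩ := hz
      rw [indep (c • a) (degree a) fun i hi => by simp [apply_eq_zero_of_degree_le a i hi]]
      simpa using iterLim_smul hC (degree a) c a 0)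

theorem iterSeminorm_eq (hz : ∃ C, ∀ n, ‖z n‖ ≤ C) (a : ℕ →₀ ℝ) {N : ℕ}
    (hN : ∀ i, N ≤ i → a i = 0) : iterSeminorm z hz a = iterLim z N a 0 := by
  change iterLim z (degree a) a 0 = _
  rw [← iterLim_add_of_zero (degree a) N (apply_eq_zero_of_degree_le a), add_comm,
    iterLim_add_of_zero N (degree a) hN]

/-- The shifted sequence has first coefficient zero, so its outermost limit is that of a constant.
-/
theorem isShiftInvariant_iterSeminorm (hz : ∃ C, ∀ n, ‖z n‖ ≤ C) :
    IsShiftInvariant (iterSeminorm z hz) := fun a => by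
  rw [iterSeminorm_eq hz a (apply_eq_zero_of_degree_le a),
    iterSeminorm_eq hz (a.mapDomain Nat.succ) (N := degree a + 1)]
  · obtain ⟨C, hC⟩ := hz
    refine tendsto_nhds_unique (tendsto_iterLim hC _ _ _) ?_
    simp only [mapDomain_succ_zero, mapDomain_succ_succ, zero_smul, add_zero]
    exact tendsto_const_nhds
  · rintro (_ | i) hi
    · omega
    · rw [mapDomain_succ_succ]
      exact apply_eq_zero_of_degree_le a i (by omega)

/-- `z` is weakly null along the fixed nonprincipal ultrafilter. -/
def IsWeaklyNull (z : ℕ → Z) : Prop :=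
  ∀ f : StrongDual ℝ Z, Tendsto (fun n => f (z n)) (hyperfilter ℕ : Filter ℕ) (𝓝 0)

/-- A continuous convex function is weakly lower semicontinuous. -/
theorem IsWeaklyNull.le_of_tendsto (hw : IsWeaklyNull z) {g : Z → ℝ} (hg : Continuous g)
    (hconv : ConvexOn ℝ Set.univ g) {v : Z} {a c : ℝ}
    (h : Tendsto (fun n => g (v + a • z n)) (hyperfilter ℕ : Filter ℕ) (𝓝 c)) : g v ≤ c := by
  by_contra! hlt
  obtain ⟨d, hcd, hdg⟩ := exists_between hlt
  -- A closed convex sublevel set is separated from `v` by a functional, yet it would contain points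
  -- `v + a • z n` that converge weakly to `v`.
  have hK : Convex ℝ {w | g w ≤ d} := by simpa using hconv.convex_le d
  obtain ⟨f, u, hfv, hfK⟩ := geometric_hahn_banach_point_closed hK
    (isClosed_le hg continuous_const) (x := v) (by simpa using hdg)
  have h1 : Tendsto (fun n => f (v + a • z n)) (hyperfilter ℕ : Filter ℕ) (𝓝 (f v)) := by
    simpa using ((hw f).const_mul a).const_add (f v)
  have h2 : ∀ᶠ n in (hyperfilter ℕ : Filter ℕ), u ≤ f (v + a • z n) := by
    filter_upwards [h.eventually_lt_const hcd] with n hn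
    exact (hfK _ hn.le).le
  exact (ge_of_tendsto h1 h2).not_gt hfv

theorem continuous_iterLim (hz : ∀ n, ‖z n‖ ≤ C) (N : ℕ) (f : ℕ → ℝ) :
    Continuous (iterLim z N f) := by
  refine (LipschitzWith.of_dist_le_mul (K := 1) fun v w => ?_).continuous
  simpa [Real.dist_eq, dist_eq_norm] using abs_iterLim_sub_le hz N f f v w

theorem convexOn_iterLim (hz : ∀ n, ‖z n‖ ≤ C) (N : ℕ) (f : ℕ → ℝ) :
    ConvexOn ℝ Set.univ (iterLim z N f) := by
  refine ⟨convex_univ, fun v _ w _ s t hs ht hst => ?_⟩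
  have h1 : f = s • f + t • f := by rw [← add_smul, hst, one_smul]
  calc iterLim z N f (s • v + t • w) = iterLim z N (s • f + t • f) (s • v + t • w) := by rw [← h1]
    _ ≤ _ := iterLim_add_le hz _ _ _ _ _
    _ = _ := by
      rw [iterLim_smul hz, iterLim_smul hz, abs_of_nonneg hs, abs_of_nonneg ht]; rfl

/-- At the deleted position, the remaining iterated limit is a continuous convex function of the
vector built so far, hence weakly lower semicontinuous. The limits outside it preserve the
inequality. -/
theorem IsWeaklyNull.iterLim_update_le (hw : IsWeaklyNull z) (hz : ∀ n, ‖z n‖ ≤ C) (N : ℕ)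
    (f : ℕ → ℝ) (i : ℕ) (v : Z) :
    iterLim z N (Function.update f i 0) v ≤ iterLim z N f v := by
  induction N generalizing f i v with
  | zero => exact le_rfl
  | succ N ih =>
    cases i with
    | zero =>
      have h1 : iterLim z (N + 1) (Function.update f 0 0) v =
          iterLim z N (fun i => f (i + 1)) v := by
        refine tendsto_nhds_unique (tendsto_iterLim hz _ _ _) ?_
        simp
      rw [h1]
      exact hw.le_of_tendsto (continuous_iterLim hz _ _) (convexOn_iterLim hz _ _)
        (tendsto_iterLim hz N f v)
    | succ i =>
      refine le_of_tendsto_of_tendsto' (tendsto_iterLim hz _ _ _) (tendsto_iterLim hz N f v)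
        fun n => ?_
      have : (fun j => Function.update f (i + 1) 0 (j + 1)) =
          Function.update (fun j => f (j + 1)) i 0 := by
        ext j
        simp [Function.update_apply]
      rw [this]
      exact ih _ _ _

theorem IsWeaklyNull.norm_le_iterLim (hw : IsWeaklyNull z) (hz : ∀ n, ‖z n‖ ≤ C) (N : ℕ)
    (f : ℕ → ℝ) (v : Z) : ‖v‖ ≤ iterLim z N f v := by
  induction N generalizing f with
  | zero => exact le_rfl
  | succ N ih =>
    refine (ih fun i => f (i + 1)).trans ?_
    exact hw.le_of_tendsto (continuous_iterLim hz _ _) (convexOn_iterLim hz _ _)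
        (tendsto_iterLim hz N f v)

theorem IsWeaklyNull.isSuppression (hw : IsWeaklyNull z) (hz : ∃ C, ∀ n, ‖z n‖ ≤ C) :
    IsSuppression (iterSeminorm z hz) := fun a i => by
  have h := apply_eq_zero_of_degree_le a
  have he : ⇑(a.erase i) = Function.update a i 0 := by
    ext j
    simp [Finsupp.erase_apply, Function.update_apply]
  rw [iterSeminorm_eq hz a h, iterSeminorm_eq hz (a.erase i) (N := degree a), he]
  · obtain ⟨C, hC⟩ := hz
    exact hw.iterLim_update_le hC _ _ _ _
  · intro j hj
    rw [Finsupp.erase_apply, h j hj, ite_self]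

end IteratedLimits

/-! ### Spreading models and iterated limits -/

section SpreadingModels

variable {X : Type*} [NormedAddCommGroup X] [NormedSpace ℝ X]

theorem exists_abs_le (a : ℕ →₀ ℝ) : ∃ B, 0 < B ∧ ∀ i, |a i| ≤ B := by
  refine ⟨∑ i ∈ a.support, |a i| + 1, by positivity, fun i => ?_⟩
  by_cases h : i ∈ a.support
  · have := Finset.single_le_sum (fun i _ => abs_nonneg (a i)) h
    linarith
  · rw [Finsupp.notMem_support_iff.1 h, abs_zero]
    positivity

theorem exists_strictMono_extension {m : ℕ} {g : Fin (m + 1) → ℕ} (hg : StrictMono g) :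
    ∃ j : ℕ → ℕ, StrictMono j ∧ ∀ i : Fin (m + 1), j i = g i := by
  refine ⟨fun i => if h : i < m + 1 then g ⟨i, h⟩ else g (Fin.last m) + i,
    strictMono_nat_of_lt_succ fun i => ?_, fun i => dif_pos i.2⟩
  by_cases h1 : i + 1 < m + 1
  · rw [dif_pos h1, dif_pos (by omega)]
    exact hg (by simp)
  · by_cases h2 : i < m + 1
    · rw [dif_neg h1, dif_pos h2]
      have : g ⟨i, h2⟩ ≤ g (Fin.last m) := hg.monotone (Fin.le_last _)
      omega
    · rw [dif_neg h1, dif_neg h2]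
      omega

/-- The one-element set `{n}`. -/
def constKSubset (n : ℕ) : KSubset 1 :=
  OrderEmbedding.ofStrictMono (fun _ => n) (Subsingleton.strictMono _)

theorem constKSubset_apply (n : ℕ) (i : Fin 1) : constKSubset n i = n := rfl

theorem sum_smul_single {N : ℕ} (a : ℕ → ℝ) (i : ℕ) :
    (∑ j : Fin N, a j • Finsupp.single (j : ℕ) (1 : ℝ)) i = if i < N then a i else 0 := by
  rw [Fin.sum_univ_eq_sum_range (fun j => a j • Finsupp.single j (1 : ℝ)) N]
  simp [Finsupp.finsetSum_apply, Finsupp.single_apply]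

/-- A form of `Generates` for families indexed by `ℕ`, of which only the first `N` members matter.
Homogeneity replaces the bound `1` on the coefficients by `B`. -/
theorem Generates.abs_sub_le {k : ℕ} {x : KSubset k → X} {M : ℕ ↪o ℕ} {δ : ℕ → ℝ}
    {p : Seminorm ℝ (ℕ →₀ ℝ)} (h : Generates k x M δ p) {l N : ℕ} (hδ : 0 ≤ δ l) (hN : N ≤ l + 1)
    (t : ℕ → KSubset k) (h1 : ∀ i j, i < j → j < N → ∀ e, t i e < t j e)
    (h2 : ∀ i j, i < N → j < N → ∀ e e', e < e' → t i e < t j e')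
    (hM : ∀ i < N, ∀ e, t i e ∈ Set.range M) (hl : ∀ i < N, ∀ e, M l ≤ t i e)
    (a : ℕ →₀ ℝ) (ha : ∀ i, N ≤ i → a i = 0) {B : ℝ} (hB : 0 < B) (hab : ∀ i, |a i| ≤ B) :
    |‖Finsupp.linearCombination ℝ (fun i => x (t i)) a‖ - p a| ≤ B * δ l := by
  rcases N with _ | m
  · have : a = 0 := Finsupp.ext fun i => ha i (Nat.zero_le i)
    simp only [this, map_zero, norm_zero, sub_zero, abs_zero]
    positivity
  · have key := h l m (by omega) (fun j => t j) ⟨fun e i j hij => h1 i j hij j.2 e,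
      fun e e' he i j => h2 i j i.2 j.2 e e' he⟩ (fun j => hM j j.2) (fun j => hl j j.2)
      (fun j => B⁻¹ * a j) fun j => by
        have : |B⁻¹ * a j| ≤ 1 := by
          rw [abs_mul, abs_inv, abs_of_pos hB, inv_mul_eq_div, div_le_one hB]
          exact hab j
        exact abs_le.1 this
    have e1 : ∑ j : Fin (m + 1), (B⁻¹ * a j) • x (t j) =
        B⁻¹ • Finsupp.linearCombination ℝ (fun i => x (t i)) a := by
      rw [linearCombination_eq_sum_range _ a ha, Finset.smul_sum,
        Fin.sum_univ_eq_sum_range (fun j => (B⁻¹ * a j) • x (t j)) (m + 1)]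
      simp only [mul_smul]
    have e2 : ∑ j : Fin (m + 1), (B⁻¹ * a j) • Finsupp.single (j : ℕ) (1 : ℝ) = B⁻¹ • a := by
      ext i
      rw [sum_smul_single (fun j => B⁻¹ * a j)]
      split_ifs with hi
      · rfl
      · simp [ha i (not_lt.1 hi)]
    rw [e1, e2, norm_smul, map_smul_eq_mul, ← mul_sub, abs_mul, abs_norm, norm_inv,
      Real.norm_of_nonneg hB.le, inv_mul_eq_div, div_le_iff₀ hB] at key
    linarith

theorem eq_of_abs_sub_le_tendsto {u v : ℝ} {δ : ℕ → ℝ} (hδ : Tendsto δ atTop (𝓝 0)) {B : ℝ} {N : ℕ}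
    (h : ∀ l ≥ N, |u - v| ≤ B * δ l) : u = v := by
  have : |u - v| ≤ B * 0 := ge_of_tendsto (hδ.const_mul B) (eventually_atTop.2 ⟨N, h⟩)
  rw [mul_zero] at this
  exact sub_eq_zero.1 (abs_nonpos_iff.1 this)

/-- Spreading models are spreading. -/
theorem IsSpreadingModel.mapDomain_eq {k : ℕ} {p : Seminorm ℝ (ℕ →₀ ℝ)}
    (h : IsSpreadingModel X k p) {n : ℕ → ℕ} (hn : StrictMono n) (a : ℕ →₀ ℝ) :
    p (a.mapDomain n) = p a := by
  obtain ⟨x, M, δ, hδ0, hδ, hG⟩ := h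
  obtain ⟨B, hB, haB⟩ := exists_abs_le a
  set N := n (degree a) + 1
  have hdN : degree a ≤ N := (hn.le_apply).trans (Nat.le_succ _)
  refine eq_of_abs_sub_le_tendsto hδ (B := 2 * B) (N := N) fun l hl => ?_
  have hmul : ∀ e e' : Fin k, e < e' → (e : ℕ) * N + N ≤ e' * N := fun e e' he => by
    rw [← Nat.succ_mul]
    exact Nat.mul_le_mul_right N he
  -- The `e`-th elements run through the `e`-th of `k` consecutive blocks of length `N`, so the
  -- first `N` sets are plegma, and so are those with indices `n i`. The same vector is therefore
  -- measured in two ways.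
  let t : ℕ → KSubset k := fun i => OrderEmbedding.ofStrictMono
    (fun e => M (l + e * N + i)) fun e e' he => M.strictMono (by have := hmul e e' he; omega)
  have ht : ∀ i e, t i e = M (l + e * N + i) := fun _ _ => rfl
  have hn0 : ∀ i, i < degree a → n i < N := fun i hi => Nat.lt_succ_of_lt (hn hi)
  have k1 := hG.abs_sub_le (hδ0 l).le (Nat.le_succ_of_le hl) t
    (fun i j hij _ e => M.strictMono (by omega))
    (fun i j hi hj e e' he => M.strictMono (by have := hmul e e' he; omega))
    (fun i _ e => ⟨_, rfl⟩) (fun i _ e => M.monotone (by omega)) (a.mapDomain n)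
    (fun i hi => by
      by_cases hr : i ∈ Set.range n
      · obtain ⟨j, rfl⟩ := hr
        rw [Finsupp.mapDomain_apply hn.injective]
        refine apply_eq_zero_of_degree_le a j ?_
        by_contra hj
        exact (hn0 j (not_le.1 hj)).not_ge hi
      · exact Finsupp.mapDomain_of_notMem_range _ _ hr) hB (fun i => by
      by_cases hr : i ∈ Set.range n
      · obtain ⟨j, rfl⟩ := hr
        rw [Finsupp.mapDomain_apply hn.injective]
        exact haB j
      · rw [Finsupp.mapDomain_of_notMem_range _ _ hr, abs_zero]
        exact hB.le)
  have k2 := hG.abs_sub_le (hδ0 l).le (Nat.le_succ_of_le (hdN.trans hl)) (fun i => t (n i))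
    (fun i j hij _ e => M.strictMono (by have := hn hij; omega))
    (fun i j hi hj e e' he => M.strictMono (by
      have := hmul e e' he
      have := hn0 i hi
      have := hn0 j hj
      omega))
    (fun i _ e => ⟨_, rfl⟩) (fun i _ e => M.monotone (by omega)) a
    (apply_eq_zero_of_degree_le a) hB haB
  rw [Finsupp.linearCombination_mapDomain] at k1
  have k3 : Finsupp.linearCombination ℝ ((fun i => x (t i)) ∘ n) a =
    Finsupp.linearCombination ℝ (fun i => x (t (n i))) a := rfl
  rw [k3] at k1
  rw [abs_le] at *
  constructor <;> linarith [k1.1, k1.2, k2.1, k2.2]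

/-- A spreading model is given by the iterated limits of a bounded sequence. -/
theorem IsSpreadingModel.exists_iterSeminorm_eq {p : Seminorm ℝ (ℕ →₀ ℝ)}
    (h : IsSpreadingModel X 1 p) :
    ∃ (y : ℕ → X) (hy : ∃ C, ∀ n, ‖y n‖ ≤ C), iterSeminorm y hy = p := by
  obtain ⟨x, M, δ, hδ0, hδ, hG⟩ := h
  let y : ℕ → X := fun n => x (constKSubset (M n))
  have hlim : ∀ (n : ℕ → ℕ) (l N : ℕ), N ≤ l + 1 → (∀ i j, i < j → j < N → n i < n j) →
      (∀ i < N, l ≤ n i) → ∀ (a : ℕ →₀ ℝ), (∀ i, N ≤ i → a i = 0) → ∀ {B : ℝ}, 0 < B →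
      (∀ i, |a i| ≤ B) → |‖∑ i ∈ Finset.range N, a i • y (n i)‖ - p a| ≤ B * δ l :=
    fun n l N hN hn hl a ha B hB haB => by
    rw [← linearCombination_eq_sum_range (fun i => y (n i)) a ha]
    exact hG.abs_sub_le (hδ0 l).le hN (fun i => constKSubset (M (n i)))
      (fun i j hij hj _ => M.strictMono (hn i j hij hj))
      (fun i j _ _ e e' he => absurd he (by simp [Subsingleton.elim e e']))
      (fun i _ _ => ⟨_, rfl⟩) (fun i hi _ => M.monotone (hl i hi)) a ha hB haB
  have hy : ∃ C, ∀ n, ‖y n‖ ≤ C := by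
    refine ⟨p (Finsupp.single 0 1) + 1 * δ 0, fun n => ?_⟩
    have := hlim (fun _ => n) 0 1 le_rfl (fun i j hij hj => by omega) (fun i _ => Nat.zero_le _)
      (Finsupp.single 0 1) (fun i hi => Finsupp.single_eq_of_ne (by omega)) one_pos
      fun i => by
        rw [Finsupp.single_apply]
        split_ifs <;> simp
    simp only [Finset.range_one, Finset.sum_singleton, Finsupp.single_eq_same, one_smul] at this
    linarith [(abs_le.1 this).2]
  refine ⟨y, hy, Seminorm.ext fun a => ?_⟩
  obtain ⟨C, hC⟩ := hy
  obtain ⟨B, hB, haB⟩ := exists_abs_le a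
  have ha := apply_eq_zero_of_degree_le a
  -- Induction on the number `d` of limits still to be taken, the first `m` indices being already
  -- fixed, increasing and at least `l`.
  have key : ∀ l, degree a ≤ l + 1 → ∀ d m, m + d = degree a → ∀ n : ℕ → ℕ,
      (∀ i j, i < j → j < m → n i < n j) → (∀ i < m, l ≤ n i) →
      |iterLim y d (fun i => a (m + i)) (∑ i ∈ Finset.range m, a i • y (n i)) - p a|
        ≤ B * δ l := by
    intro l hl d
    induction d with
    | zero =>
      intro m hm n hn hln
      rw [Nat.add_zero] at hm
      subst hm
      exact hlim n l _ hl hn hln a ha hB haB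
    | succ d ih =>
      intro m hm n hn hln
      have h1 := tendsto_iterLim hC d (fun i => a (m + i)) (∑ i ∈ Finset.range m, a i • y (n i))
      refine le_of_tendsto (h1.sub_const (p a)).abs ?_
      have h2 : ∀ᶠ c in (hyperfilter ℕ : Filter ℕ), l + ∑ i ∈ Finset.range m, n i < c :=
        Nat.hyperfilter_le_atTop (eventually_gt_atTop _)
      filter_upwards [h2] with c hc
      have hnc : ∀ i < m, n i < c := fun i hi => by
        have := Finset.single_le_sum (f := n) (fun i _ => Nat.zero_le _) (Finset.mem_range.2 hi)
        omega
      have h3 := ih (m + 1) (by omega) (Function.update n m c)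
        (fun i j hij hj => by
          rw [Function.update_of_ne (by omega)]
          rcases Nat.lt_succ_iff_lt_or_eq.1 hj with hj | rfl
          · rw [Function.update_of_ne (by omega)]
            exact hn i j hij hj
          · rw [Function.update_self]
            exact hnc i hij)
        (fun i hi => by
          rcases Nat.lt_succ_iff_lt_or_eq.1 hi with hi | rfl
          · rw [Function.update_of_ne (by omega)]
            exact hln i hi
          · rw [Function.update_self]
            omega)
      rw [Finset.sum_range_succ, Function.update_self] at h3
      have h4 : ∑ i ∈ Finset.range m, a i • y (Function.update n m c i) =
          ∑ i ∈ Finset.range m, a i • y (n i) :=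
        Finset.sum_congr rfl fun i hi => by
          rw [Function.update_of_ne (Finset.mem_range.1 hi).ne]
      rw [h4] at h3
      have h5 : (fun i => a (m + 1 + i)) = fun i => a (m + (i + 1)) := by
        ext i
        congr 1
        omega
      rwa [h5] at h3
  refine eq_of_abs_sub_le_tendsto hδ (B := B) (N := degree a) fun l hl => ?_
  have := key l (by omega) (degree a) 0 (Nat.zero_add _) id (fun i j _ hj => by omega)
    (fun i hi => by omega)
  simpa [iterSeminorm_eq ⟨C, hC⟩ a ha] using this

end SpreadingModels

/-! ### The Brunel–Sucheston theorem -/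

section BrunelSucheston

variable {Z : Type*} [NormedAddCommGroup Z] [NormedSpace ℝ Z] {z : ℕ → Z} {C : ℝ}

theorem exists_finite_net (D : ℕ) {η : ℝ} (hη : 0 < η) :
    ∃ S : Set (ℕ → ℝ), S.Finite ∧ ∀ f : ℕ → ℝ, (∀ i, |f i| ≤ 1) →
      ∃ s ∈ S, ∀ i < D, |f i - s i| ≤ η := by
  obtain ⟨T, -, hT, hcov⟩ := (isCompact_closedBall (0 : Fin D → ℝ) 1).finite_cover_balls hη
  let ext : (Fin D → ℝ) → ℕ → ℝ := fun s i => if h : i < D then s ⟨i, h⟩ else 0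
  refine ⟨ext '' T, hT.image _, fun f hf => ?_⟩
  have hmem : (fun i : Fin D => f i) ∈ Metric.closedBall (0 : Fin D → ℝ) 1 := by
    rw [mem_closedBall_zero_iff, pi_norm_le_iff_of_nonneg zero_le_one]
    exact fun i => hf i
  obtain ⟨s, hs, hfs⟩ := Set.mem_iUnion₂.1 (hcov hmem)
  refine ⟨_, ⟨s, hs, rfl⟩, fun i hi => ?_⟩
  have := (dist_pi_lt_iff hη).1 (Metric.mem_ball.1 hfs) ⟨i, hi⟩
  simp only [ext, dif_pos hi]
  exact this.le

/-- Convergence is uniform over coefficients in `[-1, 1]`: it holds simultaneously on a finite net,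
and both sides are Lipschitz in the coefficients. -/
theorem eventually_abs_iterLim_sub_le (hz : ∀ n, ‖z n‖ ≤ C) (K N : ℕ) (hN : N ≤ K) {ε : ℝ}
    (hε : 0 < ε) : ∀ᶠ n in (hyperfilter ℕ : Filter ℕ), ∀ f b : ℕ → ℝ, (∀ i, |f i| ≤ 1) →
      (∀ i, |b i| ≤ 1) →
      |iterLim z N (fun i => f (i + 1)) (∑ i ∈ Finset.range K, b i • z i + f 0 • z n) -
        iterLim z (N + 1) f (∑ i ∈ Finset.range K, b i • z i)| ≤ ε := by
  have hC : 0 ≤ C := (norm_nonneg _).trans (hz 0)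
  -- Passing to the net changes at most `K` coefficients of `b` and `K + 1` of `f`, which costs at
  -- most `C * (2 * K + 1) * η ≤ ε / 3`.
  set η : ℝ := ε / (3 * ((C + 1) * (2 * K + 1))) with hη
  have hη0 : 0 < η := by positivity
  obtain ⟨S, hS, hnet⟩ := exists_finite_net (K + 1) hη0
  have hηε : C * (2 * K + 1) * η ≤ ε / 3 := by
    rw [hη, mul_div_assoc', div_le_div_iff₀ (by positivity) (by norm_num)]
    have : 0 ≤ ε * (2 * K + 1) := by positivity
    nlinarith
  have hsum : ∀ b s : ℕ → ℝ, (∀ i < K + 1, |b i - s i| ≤ η) →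
      ‖∑ i ∈ Finset.range K, b i • z i - ∑ i ∈ Finset.range K, s i • z i‖ ≤ K * (η * C) := by
    intro b s h
    rw [← Finset.sum_sub_distrib]
    refine (norm_sum_le_of_le (n := fun _ => η * C) _ fun i hi => ?_).trans (by simp)
    rw [← sub_smul, norm_smul]
    have := Finset.mem_range.1 hi
    exact mul_le_mul (h i (by omega)) (hz i) (norm_nonneg _) hη0.le
  have hpt : ∀ᶠ n in (hyperfilter ℕ : Filter ℕ), ∀ s ∈ S, ∀ s' ∈ S,
      |iterLim z N (fun i => s (i + 1)) (∑ i ∈ Finset.range K, s' i • z i + s 0 • z n) -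
        iterLim z (N + 1) s (∑ i ∈ Finset.range K, s' i • z i)| ≤ ε / 3 := by
    refine (eventually_all_finite hS).2 fun s _ => (eventually_all_finite hS).2 fun s' _ => ?_
    have := (tendsto_iterLim hz N s (∑ i ∈ Finset.range K, s' i • z i)).sub_const
      (iterLim z (N + 1) s (∑ i ∈ Finset.range K, s' i • z i))
    rw [sub_self] at this
    have := this.abs
    rw [abs_zero] at this
    exact this.eventually_le_const (by positivity)
  filter_upwards [hpt] with n hn f b hf hb
  obtain ⟨s, hs, hfs⟩ := hnet f hf
  obtain ⟨s', hs', hbs'⟩ := hnet b hb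
  have h1 := hn s hs s' hs'
  have hNK : (N : ℝ) ≤ K := Nat.cast_le.2 hN
  have h2 : |iterLim z N (fun i => f (i + 1)) (∑ i ∈ Finset.range K, b i • z i + f 0 • z n) -
      iterLim z N (fun i => s (i + 1)) (∑ i ∈ Finset.range K, s' i • z i + s 0 • z n)|
      ≤ ε / 3 := by
    refine (abs_iterLim_sub_le hz _ _ _ _ _).trans (le_trans ?_ hηε)
    have e1 : ‖∑ i ∈ Finset.range K, b i • z i + f 0 • z n -
        (∑ i ∈ Finset.range K, s' i • z i + s 0 • z n)‖ ≤ K * (η * C) + η * C := by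
      rw [add_sub_add_comm, ← sub_smul]
      refine (norm_add_le _ _).trans (add_le_add (hsum b s' hbs') ?_)
      rw [norm_smul]
      exact mul_le_mul (hfs 0 (by omega)) (hz n) (norm_nonneg _) hη0.le
    have e2 : ∑ i ∈ Finset.range N, |f (i + 1) - s (i + 1)| ≤ K * η := by
      refine (Finset.sum_le_card_nsmul _ _ η fun i hi => hfs _ ?_).trans ?_
      · have := Finset.mem_range.1 hi
        omega
      · rw [Finset.card_range, nsmul_eq_mul]
        gcongr
    nlinarith [mul_le_mul_of_nonneg_left e2 hC]
  have h3 : |iterLim z (N + 1) s (∑ i ∈ Finset.range K, s' i • z i) -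
      iterLim z (N + 1) f (∑ i ∈ Finset.range K, b i • z i)| ≤ ε / 3 := by
    rw [abs_sub_comm]
    refine (abs_iterLim_sub_le hz _ _ _ _ _).trans (le_trans ?_ hηε)
    have e2 : ∑ i ∈ Finset.range (N + 1), |f i - s i| ≤ (K + 1) * η := by
      refine (Finset.sum_le_card_nsmul _ _ η fun i hi => hfs _ ?_).trans ?_
      · have := Finset.mem_range.1 hi
        omega
      · rw [Finset.card_range, nsmul_eq_mul, Nat.cast_succ]
        gcongr
    nlinarith [mul_le_mul_of_nonneg_left e2 hC, hsum b s' hbs']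
  rw [abs_le] at *
  constructor <;> linarith [h1.1, h1.2, h2.1, h2.2, h3.1, h3.2]

/-- The vector `v` is a combination of `z 0, …, z (K - 1)` with coefficients in `[-1, 1]`. -/
def IsUnitCombination (z : ℕ → Z) (K : ℕ) (v : Z) : Prop :=
  ∃ b : ℕ → ℝ, (∀ i, |b i| ≤ 1) ∧ v = ∑ i ∈ Finset.range K, b i • z i

theorem isUnitCombination_zero (K : ℕ) : IsUnitCombination z K 0 := ⟨0, by simp, by simp⟩

theorem IsUnitCombination.add_smul {K K' m : ℕ} {v : Z} (hv : IsUnitCombination z K v)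
    (hm : K ≤ m) (hK' : m < K') {c : ℝ} (hc : |c| ≤ 1) : IsUnitCombination z K' (v + c • z m) := by
  obtain ⟨b, hb, rfl⟩ := hv
  refine ⟨fun i => (if i < K then b i else 0) + if i = m then c else 0, fun i => ?_, ?_⟩
  · by_cases h : i < K
    · simpa [h, show i ≠ m by omega] using hb i
    · simp only [if_neg h, zero_add]
      split_ifs <;> simp [hc]
  · simp only [_root_.add_smul, Finset.sum_add_distrib, ite_smul, zero_smul, Finset.sum_ite_eq',
      Finset.mem_range, hK', if_true]
    rw [← Finset.sum_filter]
    congr 2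
    ext i
    simp
    omega

/-- Each index is chosen so late that inserting it, in place of taking the limit, costs at most a
prescribed power of `1 / 2`. Since the limits along the ultrafilter exist, no Ramsey argument is
needed. The relation `R` lets a further property be imposed on the chosen indices. -/
theorem exists_generates_iterSeminorm (hz : ∃ C, ∀ n, ‖z n‖ ≤ C) {R : ℕ → ℕ → Prop}
    (hR : ∀ {n n' m}, n ≤ n' → R n' m → R n m)
    (hRU : ∀ n, ∀ᶠ m in (hyperfilter ℕ : Filter ℕ), R n m) :
    ∃ M : ℕ ↪o ℕ, (∀ n, R n (M n)) ∧
      Generates 1 (fun s => z (s 0)) M (fun l => 2 * (1 / 2) ^ l) (iterSeminorm z hz) := by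
  obtain ⟨C, hC⟩ := id hz
  have hex : ∀ K, ∃ m, R K m ∧ K ≤ m ∧ ∀ N ≤ K, ∀ (f : ℕ → ℝ) (v : Z), (∀ i, |f i| ≤ 1) →
      IsUnitCombination z K v → |iterLim z N (fun i => f (i + 1)) (v + f 0 • z m) -
        iterLim z (N + 1) f v| ≤ (1 / 2) ^ K := fun K => by
    have h1 : ∀ᶠ m in (hyperfilter ℕ : Filter ℕ), ∀ N ∈ Set.Iic K, ∀ f b : ℕ → ℝ,
        (∀ i, |f i| ≤ 1) → (∀ i, |b i| ≤ 1) →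
        |iterLim z N (fun i => f (i + 1)) (∑ i ∈ Finset.range K, b i • z i + f 0 • z m) -
          iterLim z (N + 1) f (∑ i ∈ Finset.range K, b i • z i)| ≤ (1 / 2) ^ K :=
      (eventually_all_finite (Set.finite_Iic K)).2 fun N hN =>
        eventually_abs_iterLim_sub_le hC K N hN (by positivity)
    have h2 : ∀ᶠ m in (hyperfilter ℕ : Filter ℕ), K ≤ m :=
      Nat.hyperfilter_le_atTop (eventually_ge_atTop K)
    obtain ⟨m, hm1, hm2, hm3⟩ := (h1.and (h2.and (hRU K))).exists
    refine ⟨m, hm3, hm2, fun N hN f v hf hv => ?_⟩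
    obtain ⟨b, hb, rfl⟩ := hv
    exact hm1 N hN f b hf hb
  choose h hhR hle hlim using hex
  -- `K n` exceeds all indices chosen before stage `n`, so every vector formed earlier is a
  -- combination of `z 0, …, z (K n - 1)`.
  let K : ℕ → ℕ := fun n => Nat.rec 0 (fun _ k => h k + 1) n
  have hKs : ∀ n, K (n + 1) = h (K n) + 1 := fun n => rfl
  have hKm : StrictMono K := strictMono_nat_of_lt_succ fun n => by
    rw [hKs]
    exact Nat.lt_succ_of_le (hle _)
  let M : ℕ ↪o ℕ := OrderEmbedding.ofStrictMono (fun n => h (K n))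
    (strictMono_nat_of_lt_succ fun n => by
      have := hle (K (n + 1))
      rw [hKs] at *
      omega)
  have hMK : ∀ n, M n = h (K n) := fun _ => rfl
  -- Replacing the limits one by one gives errors `(1 / 2) ^ j i`, whose sum is at most twice the
  -- first.
  have key : ∀ (N : ℕ) (f : ℕ → ℝ) (v : Z) (j : ℕ → ℕ), (∀ i, |f i| ≤ 1) → StrictMono j →
      N ≤ j 0 + 1 → IsUnitCombination z (K (j 0)) v →
      |‖v + ∑ i ∈ Finset.range N, f i • z (M (j i))‖ - iterLim z N f v|
        ≤ 2 * (1 / 2) ^ j 0 := by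
    intro N
    induction N with
    | zero =>
      intro f v j _ _ _ _
      simp only [Finset.range_zero, Finset.sum_empty, add_zero, iterLim, sub_self, abs_zero]
      positivity
    | succ N ih =>
      intro f v j hf hj hN hv
      have hj01 : j 0 < j 1 := hj one_pos
      have h1 := ih (fun i => f (i + 1)) (v + f 0 • z (M (j 0))) (fun i => j (i + 1))
        (fun i => hf _) (fun a b hab => hj (Nat.succ_lt_succ hab)) (by
          change N ≤ j 1 + 1
          omega) (hv.add_smul (hle _) (by
          have : K (j 0 + 1) ≤ K (j 1) := hKm.monotone hj01
          rw [hKs] at this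
          exact this) (hf 0))
      have h2 := hlim (K (j 0)) N (by
        have := hKm.le_apply (x := j 0)
        omega) f v hf hv
      have h3 : ((1 : ℝ) / 2) ^ K (j 0) ≤ (1 / 2) ^ j 0 :=
        pow_le_pow_of_le_one (by norm_num) (by norm_num) hKm.le_apply
      have h4 : ((1 : ℝ) / 2) ^ j (0 + 1) ≤ (1 / 2) ^ (j 0 + 1) :=
        pow_le_pow_of_le_one (by norm_num) (by norm_num) hj01
      rw [pow_succ] at h4
      rw [add_assoc, add_comm (f 0 • z (M (j 0))),
        ← Finset.sum_range_succ' (fun i => f i • z (M (j i)))] at h1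
      rw [← hMK] at h2
      rw [abs_le] at *
      constructor <;> linarith [h1.1, h1.2, h2.1, h2.2]
  refine ⟨M, fun n => hR hKm.le_apply (hhR _), fun l m hml s hs hsM hls a ha => ?_⟩
  choose g hg using fun i => hsM i 0
  obtain ⟨j, hj, hjg⟩ := exists_strictMono_extension (g := g) fun i i' hi => by
    have := hs.1 0 hi
    simp only [← hg] at this
    exact M.lt_iff_lt.1 this
  let f : ℕ → ℝ := fun i => if h : i < m + 1 then a ⟨i, h⟩ else 0
  have hf : ∀ i : Fin (m + 1), f i = a i := fun i => dif_pos i.2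
  have hlj : l ≤ j 0 := by
    have := hls 0 0
    rw [← hg, M.le_iff_le, ← hjg] at this
    exact this
  have h1 := key (m + 1) f 0 j (fun i => by
      by_cases h : i < m + 1
      · simp only [f, dif_pos h]
        exact abs_le.2 (ha _)
      · simp only [f, dif_neg h, abs_zero, zero_le_one]) hj (by omega) (isUnitCombination_zero _)
  have e1 : ∑ i : Fin (m + 1), a i • z (s i 0) =
      0 + ∑ i ∈ Finset.range (m + 1), f i • z (M (j i)) := by
    rw [zero_add, ← Fin.sum_univ_eq_sum_range (fun i => f i • z (M (j i)))]
    simp only [hf, hjg, hg]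
  have e2 : iterSeminorm z hz (∑ i : Fin (m + 1), a i • Finsupp.single (i : ℕ) (1 : ℝ)) =
      iterLim z (m + 1) f 0 := by
    simp only [← hf]
    rw [iterSeminorm_eq hz _ (N := m + 1)]
    · exact iterLim_congr (fun i hi => by rw [sum_smul_single, if_pos hi]) 0
    · intro i hi
      rw [sum_smul_single, if_neg (by omega)]
  rw [e1, e2]
  refine h1.trans ?_
  refine mul_le_mul_of_nonneg_left ?_ two_pos.le
  exact pow_le_pow_of_le_one (by norm_num) (by norm_num) hlj

end BrunelSucheston

/-! ### Weak limits -/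

section WeakLimits

variable {Y Z : Type*} [NormedAddCommGroup Y] [NormedSpace ℝ Y] [NormedAddCommGroup Z]
  [NormedSpace ℝ Z]

variable (Z) in
/-- Bounded sequences converge weakly along the fixed nonprincipal ultrafilter. -/
def HasWeakLimits : Prop :=
  ∀ z : ℕ → Z, (∃ C, ∀ n, ‖z n‖ ≤ C) → ∃ x, IsWeaklyNull fun n => z n - x

/-- The limits of `f (z n)` define a bounded functional of `f`, and reflexivity represents it by a
vector. -/
theorem IsReflexive.hasWeakLimits (h : IsReflexive Z) : HasWeakLimits Z := by
  rintro z ⟨C, hC⟩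
  have hb : ∀ (f : StrongDual ℝ Z) n, f (z n) ∈ Set.Icc (-(‖f‖ * C)) (‖f‖ * C) := fun f n =>
    abs_le.1 (f.le_opNorm_of_le (hC n))
  choose Φ hΦ using fun f => exists_tendsto_hyperfilter (hb f)
  have hadd : ∀ f g, Φ (f + g) = Φ f + Φ g := fun f g =>
    tendsto_nhds_unique (hΦ (f + g)) ((hΦ f).add (hΦ g))
  have hsmul : ∀ (c : ℝ) f, Φ (c • f) = c • Φ f := fun c f =>
    tendsto_nhds_unique (hΦ (c • f)) ((hΦ f).const_mul c)
  have hbound : ∀ f, ‖Φ f‖ ≤ C * ‖f‖ := fun f => by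
    rw [mul_comm]
    exact abs_le.2 (isClosed_Icc.mem_of_tendsto (hΦ f) (Eventually.of_forall (hb f)))
  obtain ⟨x, hx⟩ := h (LinearMap.mkContinuous ⟨⟨Φ, hadd⟩, hsmul⟩ C hbound)
  refine ⟨x, fun f => ?_⟩
  have hxf : f x = Φ f := congrArg (fun F : StrongDual ℝ (StrongDual ℝ Z) => F f) hx
  simpa [hxf] using (hΦ f).sub_const (f x)

theorem HasWeakLimits.of_equiv (h : HasWeakLimits Y) (T : Y ≃L[ℝ] Z) : HasWeakLimits Z := by
  rintro z ⟨C, hC⟩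
  obtain ⟨x, hx⟩ := h (fun n => T.symm (z n))
    ⟨‖(T.symm : Z →L[ℝ] Y)‖ * C, fun n => (T.symm : Z →L[ℝ] Y).le_opNorm_of_le (hC n)⟩
  refine ⟨T x, fun f => ?_⟩
  simpa using hx (f.comp (T : Y →L[ℝ] Z))

/-- Up to an isomorphism, a nontrivial spreading model is given by a weakly null sequence. -/
theorem exists_isWeaklyNull_model {r : Seminorm ℝ (ℕ →₀ ℝ)} (hr : IsNontrivial r)
    (h : IsSpreadingModel Y 1 r) (T : Y ≃L[ℝ] Z) (hZ : HasWeakLimits Z) :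
    ∃ (z : ℕ → Z) (hz : ∃ C, ∀ n, ‖z n‖ ≤ C), IsWeaklyNull z ∧ IsNontrivial (iterSeminorm z hz) ∧
      Nonempty (GeneratedSpace r ≃L[ℝ] GeneratedSpace (iterSeminorm z hz)) := by
  obtain ⟨y, hy, rfl⟩ := h.exists_iterSeminorm_eq
  obtain ⟨C, hC⟩ := id hy
  have hC' : ∀ n, ‖T (y n)‖ ≤ ‖(T : Y →L[ℝ] Z)‖ * C := fun n =>
    (T : Y →L[ℝ] Z).le_opNorm_of_le (hC n)
  obtain ⟨x, hw⟩ := hZ (fun n => T (y n)) ⟨_, hC'⟩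
  have hCz : ∀ n, ‖T (y n) - x‖ ≤ ‖(T : Y →L[ℝ] Z)‖ * C + ‖x‖ := fun n =>
    (norm_sub_le _ _).trans (by gcongr; exact hC' n)
  let z : ℕ → Z := fun n => T (y n) - x
  have hz : ∃ C, ∀ n, ‖z n‖ ≤ C := ⟨_, hCz⟩
  set p := iterSeminorm z hz with hp
  have hs : IsSuppression p := hw.isSuppression hz
  have hsh : IsShiftInvariant p := isShiftInvariant_iterSeminorm hz
  -- With `s` the iterated limit for `T ∘ y`, weak lower semicontinuity gives `‖x‖ * |coordSum a| ≤
  -- s`. As `p a` differs from `s` by at most that quantity, it is at most `2 * s`, whence the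
  -- constant `3`.
  have hboth : ∀ a : ℕ →₀ ℝ, p a + ‖x‖ * |coordSum a| ≤
      (3 * ‖(T : Y →L[ℝ] Z)‖) * iterSeminorm y hy a ∧
      iterSeminorm y hy a ≤ ‖(T.symm : Z →L[ℝ] Y)‖ * (p a + ‖x‖ * |coordSum a|) := by
    intro a
    have ha := apply_eq_zero_of_degree_le a
    set N := degree a
    set s := iterLim (fun n => T (y n)) N a 0 with hs
    have hS : ∑ i ∈ Finset.range N, a i = coordSum a := by
      rw [coordSum, linearCombination_eq_sum_range _ a ha]
      simp
    have hs' : s = iterLim z N a (coordSum a • x) := by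
      rw [hs, iterLim_sub_const (fun n => T (y n)) x, zero_add, hS]
    have h1 : s ≤ ‖(T : Y →L[ℝ] Z)‖ * iterSeminorm y hy a := by
      rw [iterSeminorm_eq hy a ha]
      simpa using iterLim_comp_le (T : Y →L[ℝ] Z) hC N a 0
    have h2 : iterSeminorm y hy a ≤ ‖(T.symm : Z →L[ℝ] Y)‖ * s := by
      rw [iterSeminorm_eq hy a ha]
      simpa using iterLim_comp_le (T.symm : Z →L[ℝ] Y) hC' N a 0
    have hnorm : ‖coordSum a • x‖ = ‖x‖ * |coordSum a| := by
      rw [norm_smul, Real.norm_eq_abs, mul_comm]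
    have h3 : ‖x‖ * |coordSum a| ≤ s := by
      rw [← hnorm, hs']
      exact hw.norm_le_iterLim hCz N a _
    have h4 := abs_iterLim_sub_le hCz N a a (coordSum a • x) 0
    rw [sub_zero, hnorm] at h4
    simp only [sub_self, abs_zero, Finset.sum_const_zero, mul_zero, add_zero] at h4
    have hpa : p a = iterLim z N a 0 := iterSeminorm_eq hz a ha
    change |iterLim z N a _ - iterLim z N a 0| ≤ _ at h4
    rw [← hs', ← hpa] at h4
    have h5 := abs_le.1 h4
    refine ⟨by linarith [h5.1], h2.trans ?_⟩
    gcongr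
    linarith [h5.2]
  -- If `p` is not a norm, all unit vectors are `p`-null. The difference of two of them has
  -- coordinate sum zero, so it is null for the original model too, which is impossible.
  have hnt : IsNontrivial p := by
    intro a ha
    by_contra h0
    obtain ⟨i, hi⟩ := Finsupp.ne_iff.1 h0
    have h1 := hs.abs_apply_mul_le a i
    rw [ha] at h1
    have h2 : p (Finsupp.single i 1) = 0 := by
      refine le_antisymm ?_ (apply_nonneg _ _)
      by_contra! h
      exact (mul_pos (abs_pos.2 hi) h).not_ge h1
    have h3 : ∀ j, p (Finsupp.single j 1) = p (Finsupp.single 0 1) := fun j => by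
      induction j with
      | zero => rfl
      | succ j ih =>
        rw [← ih, ← hsh (Finsupp.single j 1), Finsupp.mapDomain_single]
    have h4 : p (Finsupp.single 0 1 - Finsupp.single 1 1) = 0 := by
      refine le_antisymm ((map_sub_le_add p _ _).trans ?_) (apply_nonneg _ _)
      rw [h3 1, ← h3 i, h2, add_zero]
    have h5 := (hboth (Finsupp.single 0 1 - Finsupp.single 1 1)).2
    have h6 : coordSum (Finsupp.single 0 1 - Finsupp.single 1 1) = 0 := by simp [coordSum]
    rw [h4, h6, abs_zero, mul_zero, add_zero, mul_zero] at h5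
    have h7 := hr _ (le_antisymm h5 (apply_nonneg _ _))
    simpa using DFunLike.congr_fun h7 0
  exact ⟨z, hz, hw, hnt, nonempty_equiv_of_coordSum hs hsh hnt (norm_nonneg x) (norm_nonneg _)
    (fun a => (hboth a).1) fun a => (hboth a).2⟩

end WeakLimits

/-! ### Composing spreading models -/

/-- The first `K` coordinates of a weakly null sequence tend to zero, so they can be removed from a
finitely supported approximation at little cost. -/
theorem IsWeaklyNull.eventually_exists_tail {q : Seminorm ℝ (ℕ →₀ ℝ)} (hq : IsUnconditional q)
    {z : ℕ → GeneratedSpace q} (hw : IsWeaklyNull z) (K : ℕ) {ε : ℝ} (hε : 0 < ε) :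
    ∀ᶠ n in (hyperfilter ℕ : Filter ℕ), ∃ u : ℕ →₀ ℝ, (∀ i < K, u i = 0) ∧
      ‖z n - toGen q u‖ ≤ ε := by
  obtain ⟨-, b, hb⟩ := hq
  have hcoord : ∀ i c, b.coord i (toGen q c) = c i := fun i c => by
    have : (b.coord i).toLinearMap ∘ₗ toGen q = Finsupp.lapply i := by
      refine Finsupp.lhom_ext' fun j => LinearMap.ext_ring ?_
      have := b.ortho i j
      rw [hb, ← toGen_single] at this
      rcases eq_or_ne i j with rfl | hij
      · simpa using this
      · simpa [hij, hij.symm] using this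
    exact DFunLike.congr_fun this c
  have hP : ∀ c, b.proj (Finset.range K) (toGen q c) =
      toGen q (∑ i ∈ Finset.range K, Finsupp.single i (c i)) := fun c => by
    rw [GeneralSchauderBasis.proj_apply, map_sum]
    refine Finset.sum_congr rfl fun i _ => ?_
    rw [hcoord, hb, ← toGen_single, ← map_smul]
    simp
  set P := b.proj (Finset.range K) with hPdef
  have h0 : Tendsto (fun n => ‖P (z n)‖) (hyperfilter ℕ : Filter ℕ) (𝓝 0) := by
    have : Tendsto (fun n => ∑ i ∈ Finset.range K, b.coord i (z n) • b i)
        (hyperfilter ℕ : Filter ℕ) (𝓝 (∑ i ∈ Finset.range K, (0 : ℝ) • b i)) :=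
      tendsto_finsetSum _ fun i _ => (hw (b.coord i)).smul_const (b i)
    simpa [hPdef] using this.norm
  filter_upwards [h0.eventually_le_const (half_pos hε)] with n hn
  -- Removing the first `K` coordinates multiplies the approximation error by at most `1 + ‖P‖`.
  obtain ⟨c, hc⟩ := exists_toGen_near q (z n) (ε := ε / 2 / (1 + ‖P‖)) (by positivity)
  refine ⟨c - ∑ i ∈ Finset.range K, Finsupp.single i (c i), fun i hi => ?_, ?_⟩
  · simp [Finsupp.single_apply, hi]
  · rw [map_sub, ← hP]
    have h1 : z n - (toGen q c - P (toGen q c)) =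
        (z n - toGen q c) - P (z n - toGen q c) + P (z n) := by
      rw [map_sub]; abel
    rw [h1]
    have h2 := P.le_opNorm (z n - toGen q c)
    have h3 := norm_sub_le (z n - toGen q c) (P (z n - toGen q c))
    have h4 := norm_add_le ((z n - toGen q c) - P (z n - toGen q c)) (P (z n))
    rw [lt_div_iff₀ (by positivity)] at hc
    linarith

/-- If `q` is an unconditional `k`-spreading model of `X`, then weakly null sequences of the space
generated by `q` have spreading models which are `(k + 1)`-spreading models of `X`. -/
theorem IsSpreadingModel.comp {X : Type*} [NormedAddCommGroup X] [NormedSpace ℝ X] {k : ℕ}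
    (hk : 1 ≤ k) {q : Seminorm ℝ (ℕ →₀ ℝ)} (h : IsSpreadingModel X k q) (hq : IsUnconditional q)
    {z : ℕ → GeneratedSpace q} (hz : ∃ C, ∀ n, ‖z n‖ ≤ C) (hw : IsWeaklyNull z) :
    IsSpreadingModel X (k + 1) (iterSeminorm z hz) := by
  obtain ⟨x, M, δ, hδ0, hδ, hG⟩ := h
  -- a subsequence which is close to a block sequence
  obtain ⟨M₀, hM₀, hG₀⟩ := exists_generates_iterSeminorm hz
    (R := fun n m => ∃ u : ℕ →₀ ℝ, (∀ i < n, u i = 0) ∧ ‖z m - toGen q u‖ ≤ (1 / 4) ^ n)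
    (fun hn ⟨u, hu, hu'⟩ => ⟨u, fun i hi => hu i (hi.trans_le hn),
      hu'.trans (pow_le_pow_of_le_one (by norm_num) (by norm_num) hn)⟩)
    fun n => hw.eventually_exists_tail hq n (by positivity)
  choose v hv0 hv using hM₀
  let w : ℕ → ℕ := fun n => Nat.rec 0 (fun _ c => c + degree (v c) + 1) n
  have hws : ∀ n, w (n + 1) = w n + degree (v (w n)) + 1 := fun _ => rfl
  have hw_mono : StrictMono w := strictMono_nat_of_lt_succ fun n => by rw [hws]; omega
  let u : ℕ → ℕ →₀ ℝ := fun n => v (w n)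
  have hu : ∀ n i, u n i ≠ 0 → w n ≤ i ∧ i < w (n + 1) := fun n i hi => by
    constructor
    · by_contra! h
      exact hi (hv0 _ _ h)
    · by_contra! h
      rw [hws] at h
      exact hi (apply_eq_zero_of_degree_le (v (w n)) _ (by omega))
  have huz : ∀ n, ‖z (M₀ (w n)) - toGen q (u n)‖ ≤ (1 / 4) ^ n := fun n =>
    (hv _).trans (pow_le_pow_of_le_one (by norm_num) (by norm_num) hw_mono.le_apply)
  -- bounds for the coefficients and the growth of the positions
  choose b hb0 hb using fun n => exists_abs_le (u n)
  let B : ℕ → ℝ := fun n => ∑ i ∈ Finset.range (n + 1), b i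
  have hB : ∀ n n', n ≤ n' → b n ≤ B n' := fun n n' hn =>
    Finset.single_le_sum (fun i _ => (hb0 i).le) (Finset.mem_range.2 (Nat.lt_succ_of_le hn))
  have hB0 : ∀ n, 0 < B n := fun n => (hb0 n).trans_le (hB n n le_rfl)
  have hψ : ∀ n, ∃ c, ∀ l ≥ c, B n * δ l ≤ (1 / 2) ^ n := fun n => by
    have := hδ.const_mul (B n)
    rw [mul_zero] at this
    exact eventually_atTop.1 (this.eventually_le_const (by positivity))
  choose ψ hψ using hψ
  -- Beyond `ψ n` the error for coefficients bounded by `B n` is negligible. The gaps of `φ` exceed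
  -- `w n`, so adding a coordinate index below `w n` to `φ n` does not reach the next value.
  let φ : ℕ → ℕ := fun n => ∑ i ∈ Finset.range (n + 1), (ψ i + w i + 1)
  have hφs : ∀ n, φ (n + 1) = φ n + (ψ (n + 1) + w (n + 1) + 1) := fun n =>
    Finset.sum_range_succ _ _
  have hφ_mono : StrictMono φ := strictMono_nat_of_lt_succ fun n => by rw [hφs]; omega
  have hφ_le : ∀ n, ψ n + w n + 1 ≤ φ n := fun n =>
    Finset.single_le_sum (f := fun i => ψ i + w i + 1) (fun _ _ => Nat.zero_le _)
      (Finset.self_mem_range_succ n)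
  have hφ_lt : ∀ n n', n < n' → φ n + w n < φ n' := fun n n' hn => by
    have h1 := hφ_mono.monotone hn
    have h2 := hφs n
    have h3 := hw_mono.monotone (Nat.le_succ n)
    simp only [Nat.succ_eq_add_one] at *
    omega
  let T : KSubset (k + 1) → ℕ → KSubset k := fun s i => OrderEmbedding.ofStrictMono
    (fun e => M (φ (s e.succ) + i)) fun e e' he => M.strictMono (by
      have := hφ_mono (s.strictMono (Fin.succ_lt_succ_iff.2 he))
      omega)
  have hT : ∀ s i e, T s i e = M (φ (s e.succ) + i) := fun _ _ _ => rfl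
  -- The element `s 0` selects the block, and each of its coordinates `i` is realised by the `k`-set
  -- that the remaining elements of `s`, translated by `i` after `φ`, determine. The constant `4`
  -- collects errors `1`, `2` and `1` from `k2`, `k3` and `k4`.
  refine ⟨fun s => Finsupp.linearCombination ℝ (fun i => x (T s i)) (u (s 0)),
    RelEmbedding.refl _, fun l => 4 * (1 / 2) ^ l, fun l => by positivity, ?_, ?_⟩
  · simpa using (tendsto_pow_atTop_nhds_zero_of_lt_one (r := (1 : ℝ) / 2) (by norm_num)
      (by norm_num)).const_mul 4
  intro l m hml s hs _ hls a ha
  have hls : ∀ j i, l ≤ s j i := hls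
  have ha1 : ∀ j, |a j| ≤ 1 := fun j => abs_le.2 (ha j)
  have hs0 : ∀ j j' (e : Fin k), s j 0 < s j' e.succ := fun j j' e =>
    hs.2 0 e.succ (Fin.succ_pos e) j j'
  have hs_mono : ∀ i, Monotone fun j => s j i := fun i => (hs.1 i).monotone
  set W := w (s (Fin.last m) 0 + 1) with hW
  -- the block which contains, or follows, a given position
  have hJ : ∀ i, ∃ j, i < W → i < w (s j 0 + 1) ∧ ∀ j' < j, w (s j' 0 + 1) ≤ i := fun i => by
    by_cases hi : i < W
    · obtain ⟨j, hj, hmin⟩ := wellFounded_lt.has_min {j | i < w (s j 0 + 1)} ⟨Fin.last m, hi⟩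
      exact ⟨j, fun _ => ⟨hj, fun j' hj' => not_lt.1 fun h => hmin j' h hj'⟩⟩
    · exact ⟨0, fun h => absurd h hi⟩
  choose J hJ using hJ
  have hJ_mono : ∀ i i', i ≤ i' → i' < W → J i ≤ J i' := fun i i' hi hi' => by
    by_contra! h
    have h1 := (hJ i (hi.trans_lt hi')).2 _ h
    have h2 := (hJ i' hi').1
    omega
  have hu_lt : ∀ j i, u (s j 0) i ≠ 0 → i < W := fun j i hi =>
    (hu _ _ hi).2.trans_le (hw_mono.monotone (Nat.succ_le_succ (hs_mono 0 (Fin.le_last j))))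
  have hJu : ∀ j i, u (s j 0) i ≠ 0 → J i = j := fun j i hi => by
    obtain ⟨h1, h2⟩ := hu _ _ hi
    obtain ⟨h3, h4⟩ := hJ i (hu_lt j i hi)
    rcases lt_trichotomy (J i) j with h | h | h
    · have := hw_mono.monotone (Nat.succ_le_of_lt (hs.1 0 h))
      simp only [Nat.succ_eq_add_one] at this
      omega
    · exact h
    · have := h4 j h
      omega
  let c : ℕ →₀ ℝ := ∑ j, a j • u (s j 0)
  have hc : ∀ i, c i = ∑ j, a j * u (s j 0) i := fun i => by
    simp [c, Finsupp.finsetSum_apply]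
  have hc0 : ∀ i, W ≤ i → c i = 0 := fun i hi => by
    rw [hc]
    refine Finset.sum_eq_zero fun j _ => ?_
    by_contra h
    exact (hu_lt j i (right_ne_zero_of_mul h)).not_ge hi
  let e₀ : Fin k := ⟨0, hk⟩
  set n₀ := s 0 e₀.succ with hn₀
  have hcB : ∀ i, |c i| ≤ B n₀ := fun i => by
    -- The blocks are disjoint, so only one contributes at `i`. By the plegma condition its index is
    -- below `n₀`, which makes `B n₀` a bound.
    rw [hc, Finset.sum_eq_single (J i)]
    · rw [abs_mul]
      calc _ ≤ 1 * b (s (J i) 0) := by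
            gcongr
            · exact ha1 _
            · exact hb _ _
        _ ≤ B n₀ := by
            rw [one_mul]
            exact hB _ _ (hs0 _ _ _).le
    · intro j _ hj
      by_contra h
      exact hj (hJu j i (right_ne_zero_of_mul h)).symm
    · simp
  have hT_eq : ∑ j, a j • Finsupp.linearCombination ℝ (fun i => x (T (s j) i)) (u (s j 0)) =
      Finsupp.linearCombination ℝ (fun i => x (T (s (J i)) i)) c := by
    simp only [c, map_sum, map_smul]
    refine Finset.sum_congr rfl fun j _ => ?_
    simp only [Finsupp.linearCombination_apply]
    congr 1
    refine Finsupp.sum_congr fun i hi => ?_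
    rw [hJu j i (Finsupp.mem_support_iff.1 hi)]
  have hWn₀ : W ≤ w n₀ := hw_mono.monotone (hs0 _ _ _)
  -- The family indexed by the coordinates `i < W` is plegma because `J` is monotone there and `i`
  -- lies below the gap of `φ`.
  have k1 := hG.abs_sub_le (l := φ n₀) (N := W) (hδ0 _).le
    (by have := hφ_le n₀; omega) (fun i => T (s (J i)) i)
    (fun i j hij hj e => by
      rw [hT, hT]
      have := hφ_mono.monotone (hs_mono e.succ (hJ_mono i j hij.le hj))
      exact M.strictMono (by simp only at this; omega))
    (fun i j hi hj e e' he => by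
      rw [hT, hT]
      have h1 := hφ_lt _ _ (hs.2 e.succ e'.succ (Fin.succ_lt_succ_iff.2 he) (J i) (J j))
      have h2 := (hJ i hi).1
      have h3 := hw_mono.monotone (Nat.succ_le_of_lt (hs0 (J i) (J i) e))
      simp only [Nat.succ_eq_add_one] at h3
      exact M.strictMono (by omega))
    (fun i _ e => ⟨_, rfl⟩)
    (fun i _ e => by
      rw [hT]
      have h1 : n₀ ≤ s (J i) e.succ := (hs_mono e₀.succ (Fin.zero_le _)).trans
        ((s (J i)).monotone (Fin.succ_le_succ_iff.2 (Nat.zero_le _)))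
      have := hφ_mono.monotone h1
      exact M.monotone (by omega))
    c hc0 (hB0 n₀) hcB
  have k2 : B n₀ * δ (φ n₀) ≤ (1 / 2) ^ l :=
    (hψ n₀ _ (by have := hφ_le n₀; omega)).trans
      (pow_le_pow_of_le_one (by norm_num) (by norm_num) (hls _ _))
  have k3 := hG₀ l m hml (fun j => constKSubset (M₀ (w (s j 0))))
    ⟨fun _ j j' hj => M₀.strictMono (hw_mono (hs.1 0 hj)),
      fun e e' he => absurd he (by simp [Subsingleton.elim e e'])⟩
    (fun j _ => ⟨_, rfl⟩) (fun j _ => M₀.monotone ((hls j 0).trans hw_mono.le_apply)) a ha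
  simp only [constKSubset_apply] at k3
  have k4 : |q c - ‖∑ j, a j • z (M₀ (w (s j 0)))‖| ≤ (1 / 2) ^ l := by
    have e1 : toGen q c = ∑ j, a j • toGen q (u (s j 0)) := by simp [c]
    rw [← norm_toGen, e1, abs_sub_comm]
    refine (abs_norm_sub_norm_le _ _).trans ?_
    rw [← Finset.sum_sub_distrib]
    refine (norm_sum_le_of_le (n := fun _ => (1 / 4 : ℝ) ^ l) _ fun j _ => ?_).trans ?_
    · rw [← smul_sub, norm_smul, Real.norm_eq_abs]
      calc _ ≤ 1 * (1 / 4 : ℝ) ^ s j 0 := by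
            gcongr
            · exact ha1 j
            · exact huz _
        _ ≤ _ := by
            rw [one_mul]
            exact pow_le_pow_of_le_one (by norm_num) (by norm_num) (hls j 0)
    -- At most `2 ^ l` blocks occur, each approximated within `(1 / 4) ^ l`.
    · have h1 : ((m + 1 : ℕ) : ℝ) ≤ 2 ^ l := by
        exact_mod_cast (Nat.succ_le_succ hml).trans (Nat.lt_two_pow_self (n := l))
      simp only [Finset.sum_const, Finset.card_univ, Fintype.card_fin, nsmul_eq_mul]
      calc _ ≤ (2 : ℝ) ^ l * (1 / 4) ^ l := by gcongr
        _ = (1 / 2) ^ l := by rw [← mul_pow]; norm_num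
  simp only [hT_eq]
  rw [abs_le] at *
  constructor <;> linarith [k1.1, k1.2, k3.1, k3.2, k4.1, k4.2]

/-! ### Iterated spreading models -/

section IteratedSpreadingModels

variable {X : Type*} [NormedAddCommGroup X] [NormedSpace ℝ X]

theorem IsIteratedSpreadingModel.isNontrivial {k : ℕ} {p : Seminorm ℝ (ℕ →₀ ℝ)}
    (h : IsIteratedSpreadingModel X k p) : IsNontrivial p := by
  cases h <;> assumption

/-- The basis of a spreading model generates itself as a spreading model. -/
theorem IsSpreadingModel.generatedSpace {k : ℕ} {p : Seminorm ℝ (ℕ →₀ ℝ)}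
    (h : IsSpreadingModel X k p) : IsSpreadingModel (GeneratedSpace p) 1 p := by
  refine ⟨fun s => unitVec p (s 0), RelEmbedding.refl _, fun n => 1 / ((n : ℝ) + 1),
    fun n => by positivity, tendsto_one_div_add_atTop_nhds_zero_nat, fun l m _ s hs _ _ a _ => ?_⟩
  obtain ⟨j, hj, hjs⟩ := exists_strictMono_extension (g := fun i => s i 0) (hs.1 0)
  have e1 : ∑ i, a i • unitVec p (s i 0) =
      toGen p ((∑ i : Fin (m + 1), a i • Finsupp.single (i : ℕ) (1 : ℝ)).mapDomain j) := by
    rw [Finsupp.mapDomain_finsetSum, map_sum]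
    refine Finset.sum_congr rfl fun i _ => ?_
    rw [Finsupp.mapDomain_smul, Finsupp.mapDomain_single, map_smul, toGen_single, hjs]
  rw [e1, norm_toGen, h.mapDomain_eq hj, sub_self, abs_zero]
  positivity

/-- This passes a reflexivity assumption on the models of order `k + 1` down to those of order `k`.
-/
theorem IsIteratedSpreadingModel.succ_self {k : ℕ} {p : Seminorm ℝ (ℕ →₀ ℝ)}
    (h : IsIteratedSpreadingModel X k p) : IsIteratedSpreadingModel X (k + 1) p := by
  refine .succ k p p h h.isNontrivial ?_
  cases h with
  | one _ _ h => exact h.generatedSpace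
  | succ _ _ _ _ _ h => exact h.generatedSpace

theorem IsIteratedSpreadingModel.one_le {k : ℕ} {p : Seminorm ℝ (ℕ →₀ ℝ)}
    (h : IsIteratedSpreadingModel X k p) : 1 ≤ k := by
  cases h <;> omega

variable (X) in
/-- Every space generated by a `k`-iterated spreading model of `X` is isomorphic to the space
generated by an unconditional `k`-spreading model of `X`. -/
def IteratedSpreadingModelsRepresentable (k : ℕ) : Prop :=
  ∀ p : Seminorm ℝ (ℕ →₀ ℝ), IsIteratedSpreadingModel X k p →
    ∃ q : Seminorm ℝ (ℕ →₀ ℝ), IsSpreadingModel X k q ∧ IsUnconditional q ∧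
      Nonempty (GeneratedSpace p ≃L[ℝ] GeneratedSpace q)

theorem iteratedSpreadingModelsRepresentable_one (hX : HasWeakLimits X) :
    IteratedSpreadingModelsRepresentable X 1 := by
  intro p h
  have hp : IsNontrivial p ∧ IsSpreadingModel X 1 p := by
    cases h with
    | one _ hp h => exact ⟨hp, h⟩
    | succ _ _ _ hq _ _ => exact absurd hq.one_le (by omega)
  obtain ⟨z, hz, hw, hnt, e⟩ :=
    exists_isWeaklyNull_model hp.1 hp.2 (ContinuousLinearEquiv.refl ℝ X) hX
  obtain ⟨M, -, hG⟩ := exists_generates_iterSeminorm hz (R := fun _ _ => True)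
    (fun _ _ => trivial) fun _ => Eventually.of_forall fun _ => trivial
  refine ⟨_, ⟨_, M, _, fun l => by positivity, ?_, hG⟩, (hw.isSuppression hz).isUnconditional hnt, e⟩
  simpa using (tendsto_pow_atTop_nhds_zero_of_lt_one (r := (1 : ℝ) / 2) (by norm_num)
    (by norm_num)).const_mul 2

/-- Weak limits are demanded only for a space `q` isomorphic to one generated by an iterated model,
so that reflexivity may be known on either side of the isomorphism: for `q` in the first part of the
theorem, for `p` in the second. -/
theorem IteratedSpreadingModelsRepresentable.succ {k : ℕ} (hk : 1 ≤ k)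
    (h : IteratedSpreadingModelsRepresentable X k)
    (hlim : ∀ p q : Seminorm ℝ (ℕ →₀ ℝ), IsIteratedSpreadingModel X k p → IsSpreadingModel X k q →
      IsUnconditional q → (GeneratedSpace p ≃L[ℝ] GeneratedSpace q) →
      HasWeakLimits (GeneratedSpace q)) :
    IteratedSpreadingModelsRepresentable X (k + 1) := by
  intro p hp
  obtain ⟨r, hr, hpnt, hpr⟩ : ∃ r, IsIteratedSpreadingModel X k r ∧ IsNontrivial p ∧
      IsSpreadingModel (GeneratedSpace r) 1 p := by
    cases hp with
    | one => omega
    | succ _ r _ hr hp h => exact ⟨r, hr, hp, h⟩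
  obtain ⟨q, hq, hqu, ⟨e⟩⟩ := h r hr
  obtain ⟨z, hz, hw, hnt, e'⟩ := exists_isWeaklyNull_model hpnt hpr e (hlim r q hr hq hqu e)
  exact ⟨_, hq.comp hk hqu hz hw, (hw.isSuppression hz).isUnconditional hnt, e'⟩

end IteratedSpreadingModels

end FiniteOrder

end

theorem mainTheorem12 {X : Type*} [NormedAddCommGroup X] [NormedSpace ℝ X] [CompleteSpace X]
    (hX : FiniteOrder.IsReflexive X) :
    ((∀ k : ℕ, 1 ≤ k → ∀ p : Seminorm ℝ (ℕ →₀ ℝ),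
        FiniteOrder.IsSpreadingModel X k p → FiniteOrder.IsUnconditional p →
          FiniteOrder.IsReflexive (FiniteOrder.GeneratedSpace p)) →
      ∀ k : ℕ, 1 ≤ k → ∀ p : Seminorm ℝ (ℕ →₀ ℝ),
        FiniteOrder.IsIteratedSpreadingModel X k p →
          ∃ q : Seminorm ℝ (ℕ →₀ ℝ),
            FiniteOrder.IsSpreadingModel X k q ∧ FiniteOrder.IsUnconditional q ∧
              Nonempty (FiniteOrder.GeneratedSpace p ≃L[ℝ] FiniteOrder.GeneratedSpace q)) ∧
    (∀ k : ℕ, 1 ≤ k →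
      (∀ p : Seminorm ℝ (ℕ →₀ ℝ), FiniteOrder.IsIteratedSpreadingModel X k p →
        FiniteOrder.IsReflexive (FiniteOrder.GeneratedSpace p)) →
      ∀ p : Seminorm ℝ (ℕ →₀ ℝ), FiniteOrder.IsIteratedSpreadingModel X (k + 1) p →
        ∃ q : Seminorm ℝ (ℕ →₀ ℝ),
          FiniteOrder.IsSpreadingModel X (k + 1) q ∧ FiniteOrder.IsUnconditional q ∧
            Nonempty (FiniteOrder.GeneratedSpace p ≃L[ℝ] FiniteOrder.GeneratedSpace q)) := by
  refine ⟨fun hrefl => ?_, ?_⟩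
  · have key : ∀ k, 1 ≤ k → FiniteOrder.IteratedSpreadingModelsRepresentable X k := by
      intro k hk
      induction k, hk using Nat.le_induction with
      | base => exact FiniteOrder.iteratedSpreadingModelsRepresentable_one hX.hasWeakLimits
      | succ k hk ih =>
        exact ih.succ hk fun _ q _ hq hqu _ => (hrefl k hk q hq hqu).hasWeakLimits
    exact key
  · intro k hk
    -- The reflexivity assumption depends on `k`, so it stays inside the induction statement.
    induction k, hk using Nat.le_induction with
    | base =>
      exact fun hrefl =>
        (FiniteOrder.iteratedSpreadingModelsRepresentable_one hX.hasWeakLimits).succ le_rfl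
          fun p _ hp _ _ e => (hrefl p hp).hasWeakLimits.of_equiv e
    | succ k hk ih =>
      exact fun hrefl =>
        FiniteOrder.IteratedSpreadingModelsRepresentable.succ (by omega)
          (ih fun p hp => hrefl p hp.succ_self)
          fun p _ hp _ _ e => (hrefl p hp).hasWeakLimits.of_equiv e
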